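/- Let $\mathrm{FIN}$ be the set of nonempty finite subsets of $\omega$. For $s,t\in\mathrm{FIN}$ write $s<_{\mathtt b}t$ if $\max s<\min t$. A block sequence is a nonempty $X\subseteq\mathrm{FIN}$ that is linearly ordered by $<_{\mathtt b}$, and $[X]$ is the set of all unions of finite block sequences contained in $X$. An ultrafilter $\mathcal H$ on $\mathrm{FIN}$ is *ordered-union* if every $A\in\mathcal H$ contains some $[X]\in\mathcal H$ with $X$ an infinite block sequence. It is *stable* if moreover for all infinite block sequences $X_n$ ($n\in\omega$) with $[X_n]\in\mathcal H$ there is an infinite block sequence $Y$ with $[Y]\in\mathcal H$ such that, for every $n$, all but finitely many members of $Y$ belong to $[X_n]$. For $s\in\mathrm{FIN}$ let $s^-=s\setminus\{\max s\}$. For $k\le \max s$, a set $A\subseteq 2^{\mathcal P(\max s)}$ is $(k,s)$-big if for every $\sigma:\mathcal P(k)\to2$ there is $\tau\in A$ with $\sigma(u)=\tau(u\cup s^-)$ for all $u\subseteq k$. Let $\mathbb T=\bigcup_{l\in\omega}\prod_{k<l}2^{\mathcal P(k)}$. For a stable ordered-union ultrafilter $\mathcal H$, the forcing $\mathbb P(\mathcal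 H)$ consists of all $T\subseteq\mathbb T$ that are closed under restrictions, contain $\emptyset$, in which every node has arbitrarily long extensions, and such that for every $k\in\omega$ the set of all $s\in\mathrm{FIN}$ with $k\le\max s$, such that $\{\tau: f^\frown\langle\tau\rangle\in T\}$ is $(k,s)$-big for every $f\in T$ of length $\max s$, belongs to $\mathcal H$. It is ordered by inclusion. If $G$ is $\mathbb P(\mathcal H)$-generic, then $F_G\in\prod_{k\in\omega}2^{\mathcal P(k)}$ denotes the unique common infinite branch of all $T\in G$, and $c_G:\mathrm{FIN}\to2$ is the generic colouring $c_G(s)=F_G(\max s)(s^-)$. **Theorem.** Let $\mathcal H$ be a stable ordered-union ultrafilter on $\mathrm{FIN}$, let $\mathbb Q$ be an $\omega^\omega$-bounding forcing notion, and let $\pi:\mathbb P(\mathcal H)\to\mathbb Q$ be a complete embedding. Then $$\Vdash_{\mathbb Q}\ \text{``there is no stable ordered-union ultrafilter on } \mathrm{FIN} \text{ extending } \mathcal H\text{''}.$$ Moreover, the generic colouring is a witness: if $c$ is the $\mathbb Q$-name for $c_{\pi^{-1}(G)}$, where $G$ is the $\mathbb Q$-generic filter, then $\mathbb Q$ forces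 that $c:\mathrm{FIN}\to 2$ is not constant on $[Y]$ for any infinite block sequence $Y$ such that $[Y]$ meets every member of $\mathcal H$. -/

import Mathlib

/-!
Combinatorics of `FIN`, the partial order of an ultrafilter on `FIN`, and forcing over
the universe `PSet.{u}` of sets with an arbitrary preorder `Q : Type u`.
-/

universe u w

namespace StableForcing

/-! ### Finite nonempty sets of natural numbers -/

/-- The nonempty finite subsets of `ω`. -/
abbrev FIN : Type := {s : Finset ℕ // s.Nonempty}

/-- The maximum of `s`. -/
def FIN.max (s : FIN) : ℕ := s.1.max' s.2

/-- The minimum of `s`. -/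
def FIN.min (s : FIN) : ℕ := s.1.min' s.2

/-- `s⁻ = s \ {max s}`. -/
def FIN.minus (s : FIN) : Finset ℕ := s.1.erase s.max

/-- The block order: `max s < min t`. -/
def Blk (s t : FIN) : Prop := s.max < t.min

/-- Block sequences: nonempty sets that are linearly ordered by the block order. -/
def IsBlockSeq (X : Set FIN) : Prop :=
  X.Nonempty ∧ ∀ s ∈ X, ∀ t ∈ X, s = t ∨ Blk s t ∨ Blk t s

/-- Infinite block sequences. -/
def IsInfBlockSeq (X : Set FIN) : Prop := IsBlockSeq X ∧ X.Infinite

/-- `[A]`: all unions of finite block sequences from `A`. -/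
def unions (A : Set FIN) : Set FIN :=
  {s | ∃ F : Finset FIN, (F : Set FIN) ⊆ A ∧ IsBlockSeq (F : Set FIN) ∧
    s.1 = F.biUnion Subtype.val}

/-- Ordered-union ultrafilters: there is a base of sets `[X]`, `X` an infinite block sequence. -/
def IsOrderedUnion (H : Ultrafilter FIN) : Prop :=
  ∀ A ∈ H, ∃ X : Set FIN, IsInfBlockSeq X ∧ unions X ∈ H ∧ unions X ⊆ A

/-- `Y` almost refines `X`: all but finitely many members of `Y` belong to `[X]`. -/
def AlmostRefines (Y X : Set FIN) : Prop := {t ∈ Y | t ∉ unions X}.Finite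

/-- Stable ordered-union ultrafilters. -/
def IsStableOrderedUnion (H : Ultrafilter FIN) : Prop :=
  IsOrderedUnion H ∧
    ∀ X : ℕ → Set FIN, (∀ n, IsInfBlockSeq (X n) ∧ unions (X n) ∈ H) →
      ∃ Y : Set FIN, IsInfBlockSeq Y ∧ unions Y ∈ H ∧ ∀ n, AlmostRefines Y (X n)

/-! ### The partial order `ℙ(H)` -/

/-- `2^{𝒫(k)}`, the functions from the power set of `k = {0, …, k - 1}` to `2`. -/
abbrev Col (k : ℕ) : Type := {x : Finset ℕ // x ⊆ Finset.range k} → Bool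

/-- `∏_{k < l} 2^{𝒫(k)}`. -/
abbrev Node (l : ℕ) : Type := ∀ k : ℕ, k < l → Col k

/-- The restriction of a node of length `l` to length `l' ≤ l`. -/
def Node.restrict {l l' : ℕ} (f : Node l) (h : l' ≤ l) : Node l' :=
  fun k hk => f k (lt_of_lt_of_le hk h)

/-- The tree `𝕋 = ⋃_l ∏_{k < l} 2^{𝒫(k)}`; `⟨l, f⟩` is the function `f` with domain `l`. -/
abbrev TT : Type := Σ l : ℕ, Node l

/-- `succ_T(f)`, the set of all `τ` such that `f ⌢ ⟨τ⟩ ∈ T`. -/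
def succs (T : Set TT) {l : ℕ} (f : Node l) : Set (Col l) :=
  {τ | ∃ g : Node (l + 1), (⟨l + 1, g⟩ : TT) ∈ T ∧
    g.restrict (Nat.le_succ l) = f ∧ g l (Nat.lt_succ_self l) = τ}

theorem FIN.minus_subset (s : FIN) : s.minus ⊆ Finset.range s.max := by
  intro x hx
  have h := Finset.mem_erase.1 hx
  exact Finset.mem_range.2 (lt_of_le_of_ne (Finset.le_max' _ _ h.2) h.1)

theorem union_minus_subset {k : ℕ} {s : FIN} (hk : k ≤ s.max) {x : Finset ℕ}
    (hx : x ⊆ Finset.range k) : x ∪ s.minus ⊆ Finset.range s.max :=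
  Finset.union_subset (hx.trans (Finset.range_subset_range.2 hk)) s.minus_subset

/-- `(k, s)`-big subsets of `2^{𝒫(max s)}`, for `k ≤ max s`. -/
def IsBig (k : ℕ) (s : FIN) (hk : k ≤ s.max) (A : Set (Col s.max)) : Prop :=
  ∀ σ : Col k, ∃ τ ∈ A, ∀ (x : Finset ℕ) (hx : x ⊆ Finset.range k),
    σ ⟨x, hx⟩ = τ ⟨x ∪ s.minus, union_minus_subset hk hx⟩

/-- The set `H_{T,k}` of all `s` with `k ≤ max s` such that all successor sets of nodes of
length `max s` in `T` are `(k, s)`-big. -/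
def bigSet (T : Set TT) (k : ℕ) : Set FIN :=
  {s | ∃ hk : k ≤ s.max, ∀ f : Node s.max, (⟨s.max, f⟩ : TT) ∈ T → IsBig k s hk (succs T f)}

/-- `H`-conditions. -/
structure IsCondition (H : Ultrafilter FIN) (T : Set TT) : Prop where
  /-- `T` is closed under restrictions. -/
  subtree : ∀ (l : ℕ) (f : Node l), (⟨l, f⟩ : TT) ∈ T → ∀ (l' : ℕ) (h : l' ≤ l),
    (⟨l', f.restrict h⟩ : TT) ∈ T
  /-- The empty sequence belongs to `T`. -/
  root : ∀ f : Node 0, (⟨0, f⟩ : TT) ∈ T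
  /-- Every node of `T` has arbitrarily long extensions in `T`. -/
  extend : ∀ (l : ℕ) (f : Node l), (⟨l, f⟩ : TT) ∈ T → ∀ n : ℕ, l ≤ n →
    ∃ (m : ℕ) (g : Node m) (h : l ≤ m), (⟨m, g⟩ : TT) ∈ T ∧ g.restrict h = f ∧ n ≤ m
  big : ∀ k : ℕ, bigSet T k ∈ H

/-- The forcing notion `ℙ(H)`, ordered by inclusion. -/
def Cond (H : Ultrafilter FIN) : Type := {T : Set TT // IsCondition H T}

instance (H : Ultrafilter FIN) : PartialOrder (Cond H) :=
  inferInstanceAs (PartialOrder {T : Set TT // IsCondition H T})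

/-- The infinite branches through `T`. -/
def branches (T : Set TT) : Set (∀ k : ℕ, Col k) :=
  {F | ∀ l : ℕ, (⟨l, fun k _ => F k⟩ : TT) ∈ T}

/-- All branches `F` of the condition `p` satisfy `F(max s)(s⁻) = t`. -/
def Decides {H : Ultrafilter FIN} (p : Cond H) (s : FIN) (t : Bool) : Prop :=
  ∀ F ∈ branches p.1, F s.max ⟨s.minus, s.minus_subset⟩ = t

/-! ### Complete embeddings -/

/-- Two conditions are compatible if they have a common extension. -/
def Compat {P : Type w} [Preorder P] (p q : P) : Prop := ∃ r, r ≤ p ∧ r ≤ q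

/-- Complete embeddings of forcing notions. -/
structure IsCompleteEmbedding {P : Type w} {Q : Type u} [Preorder P] [Preorder Q]
    (π : P → Q) : Prop where
  mono : ∀ p p' : P, p' ≤ p → π p' ≤ π p
  compat_iff : ∀ p p' : P, Compat p p' ↔ Compat (π p) (π p')
  /-- Every `q` has a reduction. -/
  reduction : ∀ q : Q, ∃ p : P, ∀ p' ≤ p, Compat (π p') q

/-! ### Formulas of the language of set theory -/

/-- Formulas of the first-order language with `∈` and `=`, with parameters from `V`
(a quantifier is applied to a formula-valued function of the bound variable). -/
inductive SetFormula (V : Type w) : Type w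
  | mem (x y : V) : SetFormula V
  | eq (x y : V) : SetFormula V
  | neg (φ : SetFormula V) : SetFormula V
  | and (φ ψ : SetFormula V) : SetFormula V
  | all (φ : V → SetFormula V) : SetFormula V

namespace SetFormula

variable {V : Type w}

infix:60 " ∈ₛ " => SetFormula.mem
infix:60 " =ₛ " => SetFormula.eq
prefix:55 "¬ₛ " => SetFormula.neg
infixr:50 " ∧ₛ " => SetFormula.and

/-- Disjunction. -/
def or (φ ψ : SetFormula V) : SetFormula V := ¬ₛ (¬ₛ φ ∧ₛ ¬ₛ ψ)
infixr:45 " ∨ₛ " => SetFormula.or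

/-- Implication. -/
def imp (φ ψ : SetFormula V) : SetFormula V := ¬ₛ (φ ∧ₛ ¬ₛ ψ)
infixr:40 " →ₛ " => SetFormula.imp

/-- Equivalence. -/
def iff (φ ψ : SetFormula V) : SetFormula V := (φ →ₛ ψ) ∧ₛ (ψ →ₛ φ)
infix:35 " ↔ₛ " => SetFormula.iff

/-- Existential quantification. -/
def ex (φ : V → SetFormula V) : SetFormula V := ¬ₛ all fun x => ¬ₛ φ x

/-- `∀ z ∈ x, φ z`. -/
def allIn (x : V) (φ : V → SetFormula V) : SetFormula V := all fun z => z ∈ₛ x →ₛ φ z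

/-- `∃ z ∈ x, φ z`. -/
def exIn (x : V) (φ : V → SetFormula V) : SetFormula V := ex fun z => z ∈ₛ x ∧ₛ φ z

/-- `x ⊆ y`. -/
def subset (x y : V) : SetFormula V := allIn x fun z => z ∈ₛ y

/-- `x = ∅`. -/
def isEmpty (x : V) : SetFormula V := all fun z => ¬ₛ (z ∈ₛ x)

/-- `y = x ∪ {x}`. -/
def isSucc (y x : V) : SetFormula V := all fun z => z ∈ₛ y ↔ₛ (z ∈ₛ x ∨ₛ z =ₛ x)

/-- `I` contains `∅` and is closed under `x ↦ x ∪ {x}`. -/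
def isInductive (I : V) : SetFormula V :=
  (exIn I fun e => isEmpty e) ∧ₛ allIn I fun x => exIn I fun y => isSucc y x

/-- `x ∈ ω`: `x` belongs to every inductive set. -/
def isNat (x : V) : SetFormula V := all fun I => isInductive I →ₛ x ∈ₛ I

/-- `x ∈ 2 = {0, 1}`, where `0 = ∅` and `1 = {∅}`. -/
def isTwo (x : V) : SetFormula V := isEmpty x ∨ₛ ex fun e => isEmpty e ∧ₛ isSucc x e

/-- `w = {x, y}`. -/
def isUPair (w x y : V) : SetFormula V := all fun v => v ∈ₛ w ↔ₛ (v =ₛ x ∨ₛ v =ₛ y)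

/-- `z = (x, y) = {{x}, {x, y}}`. -/
def isPair (z x y : V) : SetFormula V :=
  ex fun a => ex fun b => isUPair a x x ∧ₛ isUPair b x y ∧ₛ isUPair z a b

/-- `(x, y) ∈ f`. -/
def pairIn (f x y : V) : SetFormula V := exIn f fun z => isPair z x y

/-- `f` is a function from the class `D` to the class `R`. -/
def isFun (D R : V → SetFormula V) (f : V) : SetFormula V :=
  (allIn f fun z => ex fun x => ex fun y => D x ∧ₛ R y ∧ₛ isPair z x y) ∧ₛ
    all fun x => D x →ₛ
      ex fun y => pairIn f x y ∧ₛ all fun y' => pairIn f x y' →ₛ y' =ₛ y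

/-- `s ∈ FIN`: `s` is a nonempty and bounded (that is, finite) subset of `ω`. -/
def isFIN (s : V) : SetFormula V :=
  (allIn s fun k => isNat k) ∧ₛ (ex fun k => k ∈ₛ s) ∧ₛ
    ex fun n => isNat n ∧ₛ allIn s fun k => k ∈ₛ n

/-- `A ⊆ FIN`. -/
def subFIN (A : V) : SetFormula V := allIn A fun s => isFIN s

/-- The block order `max s < min t`: every element of `s` is less than every element of `t`. -/
def blk (s t : V) : SetFormula V := allIn s fun i => allIn t fun j => i ∈ₛ j

/-- `X` is a block sequence. -/
def isBlockSeq (X : V) : SetFormula V :=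
  subFIN X ∧ₛ (ex fun s => s ∈ₛ X) ∧ₛ
    allIn X fun s => allIn X fun t => s =ₛ t ∨ₛ blk s t ∨ₛ blk t s

/-- `X` is an infinite block sequence (a block sequence without a last member). -/
def isInfBlockSeq (X : V) : SetFormula V :=
  isBlockSeq X ∧ₛ allIn X fun s => exIn X fun t => blk s t

/-- `s ∈ [X]`, for a block sequence `X`: `s ∈ FIN` is a union of members of `X` (the members
of `X` that are subsets of `s` are finitely many because `s` is finite). -/
def inUnions (s X : V) : SetFormula V :=
  isFIN s ∧ₛ allIn s fun k => exIn X fun t => k ∈ₛ t ∧ₛ subset t s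

/-- `C = [X]`. -/
def isUnions (C X : V) : SetFormula V := all fun s => s ∈ₛ C ↔ₛ inUnions s X

/-- `[X] ∈ U`. -/
def unionsIn (X U : V) : SetFormula V := exIn U fun C => isUnions C X

/-- `U` is an ultrafilter on `FIN`. -/
def isUltrafilter (U : V) : SetFormula V :=
  (allIn U fun A => subFIN A ∧ₛ ex fun s => s ∈ₛ A) ∧ₛ
  (allIn U fun A => all fun B => subFIN B →ₛ subset A B →ₛ B ∈ₛ U) ∧ₛ
  (allIn U fun A => allIn U fun B => exIn U fun C =>
    all fun s => s ∈ₛ C ↔ₛ (s ∈ₛ A ∧ₛ s ∈ₛ B)) ∧ₛ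
  (all fun A => subFIN A →ₛ
    (A ∈ₛ U ∨ₛ exIn U fun C => all fun s => s ∈ₛ C ↔ₛ (isFIN s ∧ₛ ¬ₛ (s ∈ₛ A))))

/-- `U` is an ordered-union ultrafilter on `FIN`. -/
def isOrderedUnion (U : V) : SetFormula V :=
  isUltrafilter U ∧ₛ allIn U fun A => ex fun X => isInfBlockSeq X ∧ₛ
    exIn U fun C => isUnions C X ∧ₛ subset C A

/-- `Y` almost refines `X`, for infinite block sequences: all members of `Y` beyond some member
of `Y` belong to `[X]`. -/
def almostRefines (Y X : V) : SetFormula V :=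
  exIn Y fun s => allIn Y fun t => blk s t →ₛ inUnions t X

/-- `U` is a stable ordered-union ultrafilter on `FIN`; `f` is the sequence `n ↦ Xₙ`. -/
def isStableOrderedUnion (U : V) : SetFormula V :=
  isOrderedUnion U ∧ₛ
    all fun f => isFun isNat (fun X => isInfBlockSeq X ∧ₛ unionsIn X U) f →ₛ
      ex fun Y => isInfBlockSeq Y ∧ₛ unionsIn Y U ∧ₛ
        all fun n => all fun X => pairIn f n X →ₛ almostRefines Y X

/-- `c : FIN → 2`, and `c` is not constant on `[Y]` whenever `Y` is an infinite block
sequence such that `[Y]` meets every member of `G`. -/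
def isWitness (c G : V) : SetFormula V :=
  isFun isFIN isTwo c ∧ₛ
    all fun Y => isInfBlockSeq Y →ₛ (allIn G fun B => exIn B fun s => inUnions s Y) →ₛ
      ¬ₛ ex fun t => all fun s => inUnions s Y →ₛ pairIn c s t

end SetFormula

/-! ### Names and the forcing relation -/

/-- `Q`-names: a name is a set of pairs `(x, q)` of a name `x` and a condition `q`. The name
`mk ι val cond` consists of the pairs `(val i, q)` with `i : ι` and `q ∈ cond i`. -/
inductive Name (Q : Type u) : Type (u + 1)
  | mk (ι : Type u) (val : ι → Name Q) (cond : ι → Set Q) : Name Q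

/-- The canonical name of a set of the ground model. -/
def check (Q : Type u) : PSet.{u} → Name Q
  | .mk ι val => .mk ι (fun i => check Q (val i)) (fun _ => Set.univ)

section Forcing

variable {Q : Type u} [Preorder Q]

/-- `p ⊩ x = y`: if `(a, q)` belongs to one of the names, then below every common extension of `p`
and `q` it is dense to force that `a` is equal to some `b`, where `(b, q')` belongs to the other name
and `q'` is weaker than the condition. -/
def forcesEq : Name Q → Name Q → Q → Prop
  | .mk _ a c, .mk _ b d => fun p =>
    (∀ i, ∀ q ∈ c i, ∀ r ≤ p, r ≤ q → ∃ r' ≤ r, ∃ j, (∃ q' ∈ d j, r' ≤ q') ∧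
      forcesEq (a i) (b j) r') ∧
    (∀ j, ∀ q ∈ d j, ∀ r ≤ p, r ≤ q → ∃ r' ≤ r, ∃ i, (∃ q' ∈ c i, r' ≤ q') ∧
      forcesEq (a i) (b j) r')

/-- `p ⊩ x ∈ y`: below `p` it is dense to force that `x` is equal to some `b`, where `(b, q)`
belongs to `y` and `q` is weaker than the condition. -/
def forcesMem (x : Name Q) : Name Q → Q → Prop
  | .mk _ b d => fun p =>
    ∀ r ≤ p, ∃ r' ≤ r, ∃ j, (∃ q ∈ d j, r' ≤ q) ∧ forcesEq x (b j) r'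

/-- The forcing relation. -/
def Forces : Q → SetFormula (Name Q) → Prop
  | p, .mem x y => forcesMem x y p
  | p, .eq x y => forcesEq x y p
  | p, .neg φ => ∀ q ≤ p, ¬ Forces q φ
  | p, .and φ ψ => Forces p φ ∧ Forces p ψ
  | p, .all φ => ∀ x : Name Q, Forces p (φ x)

infix:25 " ⊩ " => Forces

/-- `Q` is `ω^ω`-bounding: if `p` forces `f` to be a function from `ω` to `ω`, then some `q ≤ p`
and some `ψ : ω → ω` of the ground model are such that `q` forces `f(n) ≤ ψ(n)` for all `n`. -/
def IsBounding (Q : Type u) [Preorder Q] : Prop :=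
  ∀ (f : Name Q) (p : Q), (p ⊩ SetFormula.isFun SetFormula.isNat SetFormula.isNat f) →
    ∃ q ≤ p, ∃ ψ : ℕ → ℕ, ∀ n : ℕ,
      q ⊩ .ex fun m => .and (.pairIn f (check Q (PSet.ofNat n)) m)
        (.or (.mem m (check Q (PSet.ofNat (ψ n)))) (.eq m (check Q (PSet.ofNat (ψ n)))))

end Forcing

/-! ### Objects of the ground model as sets; natural numbers are von Neumann numbers -/

/-- `s ∈ FIN` as a set. -/
def codeFIN (s : FIN) : PSet.{u} := ⟨ULift.{u} {n : ℕ // n ∈ s.1}, fun n => PSet.ofNat n.down⟩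

/-- `A ⊆ FIN` as a set. -/
def codeSet (A : Set FIN) : PSet.{u} := ⟨ULift.{u} A, fun s => codeFIN s.down⟩

/-- An ultrafilter on `FIN` as a set of sets. -/
def codeUltrafilter (H : Ultrafilter FIN) : PSet.{u} :=
  ⟨ULift.{u} {A : Set FIN // A ∈ H}, fun A => codeSet A.down⟩

/-- The elements of `2 = {0, 1}` as sets. -/
def codeBool (t : Bool) : PSet.{u} := PSet.ofNat t.toNat

/-- The ordered pair `{{x}, {x, y}}`. -/
def codePair (x y : PSet.{u}) : PSet.{u} := {{x}, {x, y}}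

/-- The `Q`-name, induced by `π : ℙ(H) → Q`, of the generic colouring `c : FIN → 2`,
`c(s) = F(max s)(s⁻)`, where `F` is the unique common branch of all conditions `p` for which
`π p` belongs to the `Q`-generic filter. The pair `(s, t)` is put into `c` by all `π p` such that
all branches `F` of `p` satisfy `F(max s)(s⁻) = t`. -/
def genericColouring {H : Ultrafilter FIN} {Q : Type u} (π : Cond H → Q) : Name Q :=
  .mk (ULift.{u} (FIN × Bool))
    (fun x => check Q (codePair (codeFIN x.down.1) (codeBool x.down.2)))
    (fun x => {q | ∃ p : Cond H, Decides p x.down.1 x.down.2 ∧ q = π p})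

end StableForcing

open StableForcing

/-! The heart of the matter is that a condition can be thinned so that the generic colour of `s`
changes whenever a set from a prescribed interval is inserted into `s`. Bigness makes this possible.
If `x` is `(b, x)`-big, the values on `w ∪ x⁻` for `w ⊆ b` may be prescribed freely. For `a ≤ b`,
one can thus copy any pattern from subsets `v` of `a`, and negate it as soon as `w` meets `[a, b)`.
What survives is still `(a, x)`-big (`mem_bigSet_flipTree`).

Given `ψ : ω → ω`, stability yields a block sequence `X` with `[X] ∈ H` whose members `x` are big
for `max (a x) (ψ (a x))`, where `a x` lies just above the preceding blocks. The thinning at all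
levels `max x` is a condition: if `s ∈ [X]` ends with the block `x`, then `s⁻` is `x⁻` together with
a subset of `a x`, so bigness at `s` follows from bigness at `x`. Below this condition the colours
of `s` and `s ∪ y` differ for each `y` inside `[a x, ψ (a x))` (`exists_flipping`). The set `y` is
inserted before `max s`; it need not follow `s`.

Now suppose that `[Y]` meets every member of `H` and has a constant colour. Boundedness gives a
ground model `ψ` such that every `[n, ψ n)` contains a member of `Y`. Take the thinned condition for
this `ψ`, some `s ∈ [X] ∩ [Y]`, and a member `y` of `Y` in the corresponding interval. Then `s` and
`s ∪ y` both belong to `[Y]` but have different colours (`not_forces_constant`). If an ordered-union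
ultrafilter extended `H`, it would contain one of the two colour classes, hence some `[Y]` inside
it, and this `[Y]` would meet every member of `H`. -/

namespace StableForcing

/-! ### Basic theory of the forcing relation -/

section ForcingBasics

variable {Q : Type u} [Preorder Q] {p q : Q}

/-- `P` holds on a set of conditions that is dense below `p`. -/
def Densely (p : Q) (P : Q → Prop) : Prop := ∀ q ≤ p, ∃ r ≤ q, P r

theorem Densely.mono {P : Q → Prop} (h : Densely p P) (hq : q ≤ p) : Densely q P :=
  fun r hr => h r (hr.trans hq)

theorem Densely.imp {P P' : Q → Prop} (h : Densely p P) (h' : ∀ r ≤ p, P r → P' r) :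
    Densely p P' := fun q hq => by
  obtain ⟨r, hr, hP⟩ := h q hq
  exact ⟨r, hr, h' r (hr.trans hq) hP⟩

theorem Densely.bind {P P' : Q → Prop} (h : Densely p P) (h' : ∀ r ≤ p, P r → Densely r P') :
    Densely p P' := fun q hq => by
  obtain ⟨r, hr, hP⟩ := h q hq
  obtain ⟨r', hr', hP'⟩ := h' r (hr.trans hq) hP r le_rfl
  exact ⟨r', hr'.trans hr, hP'⟩

theorem Densely.exists {P : Q → Prop} (h : Densely p P) : ∃ r ≤ p, P r := h p le_rfl

theorem densely_of_forall {P : Q → Prop} (h : ∀ r ≤ p, P r) : Densely p P :=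
  fun q hq => ⟨q, le_rfl, h q hq⟩

theorem forcesEq_mono {x y : Name Q} (h : forcesEq x y p) (hq : q ≤ p) : forcesEq x y q := by
  cases x; cases y
  rw [forcesEq] at h ⊢
  exact ⟨fun i t ht r hr => h.1 i t ht r (hr.trans hq),
    fun j t ht r hr => h.2 j t ht r (hr.trans hq)⟩

theorem forcesEq_of_densely {x y : Name Q} (h : Densely p (forcesEq x y)) : forcesEq x y p := by
  cases x; cases y
  rw [forcesEq]
  refine ⟨fun i t ht r hr hrt => ?_, fun j t ht r hr hrt => ?_⟩
  · obtain ⟨r₁, h₁, he⟩ := h r hr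
    rw [forcesEq] at he
    obtain ⟨r₂, h₂, hh⟩ := he.1 i t ht r₁ le_rfl (h₁.trans hrt)
    exact ⟨r₂, h₂.trans h₁, hh⟩
  · obtain ⟨r₁, h₁, he⟩ := h r hr
    rw [forcesEq] at he
    obtain ⟨r₂, h₂, hh⟩ := he.2 j t ht r₁ le_rfl (h₁.trans hrt)
    exact ⟨r₂, h₂.trans h₁, hh⟩

theorem forcesMem_mono {x y : Name Q} (h : forcesMem x y p) (hq : q ≤ p) : forcesMem x y q := by
  cases y
  exact fun r hr => h r (hr.trans hq)

theorem forcesMem_of_densely {x y : Name Q} (h : Densely p (forcesMem x y)) :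
    forcesMem x y p := by
  cases y
  intro r hr
  obtain ⟨r₁, h₁, he⟩ := h r hr
  obtain ⟨r₂, h₂, hh⟩ := he r₁ le_rfl
  exact ⟨r₂, h₂.trans h₁, hh⟩

theorem Forces.mono {φ : SetFormula (Name Q)} (h : p ⊩ φ) (hq : q ≤ p) : q ⊩ φ := by
  induction φ with
  | mem x y => exact forcesMem_mono h hq
  | eq x y => exact forcesEq_mono h hq
  | neg φ _ => exact fun r hr => h r (hr.trans hq)
  | and φ ψ h₁ h₂ => exact ⟨h₁ h.1, h₂ h.2⟩
  | all φ ih => exact fun x => ih x (h x)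

/-- The atomic clauses already speak of dense sets, and a condition that forces a negation is
incompatible with all conditions forcing the formula. Hence truth is local, and later arguments may
always pass to a stronger condition that decides what is needed. -/
theorem forces_of_densely {φ : SetFormula (Name Q)} (h : Densely p fun r => r ⊩ φ) : p ⊩ φ := by
  induction φ generalizing p with
  | mem x y => exact forcesMem_of_densely h
  | eq x y => exact forcesEq_of_densely h
  | neg φ _ =>
    intro r hr hφ
    obtain ⟨r₁, h₁, hn⟩ := h r hr
    exact hn r₁ le_rfl (hφ.mono h₁)
  | and φ ψ h₁ h₂ => exact ⟨h₁ (h.imp fun _ _ h => h.1), h₂ (h.imp fun _ _ h => h.2)⟩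
  | all φ ih => exact fun x => ih x (h.imp fun _ _ h => h x)

theorem Densely.forces {P : Q → Prop} {φ : SetFormula (Name Q)} (h : Densely p P)
    (h' : ∀ r ≤ p, P r → r ⊩ φ) : p ⊩ φ := forces_of_densely (h.imp h')

theorem forces_and {φ ψ : SetFormula (Name Q)} : (p ⊩ .and φ ψ) ↔ (p ⊩ φ) ∧ (p ⊩ ψ) := Iff.rfl

theorem forces_all {φ : Name Q → SetFormula (Name Q)} : (p ⊩ .all φ) ↔ ∀ x, p ⊩ φ x := Iff.rfl

theorem forces_or {φ ψ : SetFormula (Name Q)} :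
    (p ⊩ .or φ ψ) ↔ Densely p fun r => (r ⊩ φ) ∨ (r ⊩ ψ) := by
  constructor
  · intro h q hq
    by_contra! hc
    exact h q hq ⟨fun r hr h' => (hc r hr).1 h', fun r hr h' => (hc r hr).2 h'⟩
  · intro h q hq hn
    obtain ⟨r, hr, h' | h'⟩ := h q hq
    · exact hn.1 r hr h'
    · exact hn.2 r hr h'

theorem forces_imp {φ ψ : SetFormula (Name Q)} :
    (p ⊩ .imp φ ψ) ↔ ∀ q ≤ p, (q ⊩ φ) → (q ⊩ ψ) := by
  constructor
  · intro h q hq hφ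
    refine forces_of_densely fun r hr => ?_
    by_contra! hc
    exact h r (hr.trans hq) ⟨hφ.mono hr, fun r' hr' h' => hc r' hr' h'⟩
  · intro h q hq hn
    exact hn.2 q le_rfl (h q hq hn.1)

theorem forces_iff {φ ψ : SetFormula (Name Q)} :
    (p ⊩ .iff φ ψ) ↔ ∀ q ≤ p, (q ⊩ φ) ↔ (q ⊩ ψ) := by
  rw [SetFormula.iff, forces_and, forces_imp, forces_imp]
  exact ⟨fun h q hq => ⟨h.1 q hq, h.2 q hq⟩,
    fun h => ⟨fun q hq => (h q hq).1, fun q hq => (h q hq).2⟩⟩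

/-- The quantifier abbreviates `¬∀¬`, so witnesses appear only densely and may vary with the
condition. They are never mixed into a single name. -/
theorem forces_ex {φ : Name Q → SetFormula (Name Q)} :
    (p ⊩ .ex φ) ↔ Densely p fun r => ∃ x, r ⊩ φ x := by
  constructor
  · intro h q hq
    by_contra! hc
    exact h q hq fun x r hr h' => hc r hr x h'
  · intro h q hq hn
    obtain ⟨r, hr, x, hx⟩ := h q hq
    exact hn x r hr hx

theorem forces_ex_of {φ : Name Q → SetFormula (Name Q)} (x : Name Q) (h : p ⊩ φ x) :
    p ⊩ .ex φ :=
  forces_ex.2 (densely_of_forall fun _ hr => ⟨x, h.mono hr⟩)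

theorem forces_allIn {x : Name Q} {φ : Name Q → SetFormula (Name Q)} :
    (p ⊩ .allIn x φ) ↔ ∀ z, ∀ q ≤ p, (q ⊩ .mem z x) → (q ⊩ φ z) := by
  rw [SetFormula.allIn, forces_all]
  exact forall_congr' fun z => forces_imp

theorem forces_exIn {x : Name Q} {φ : Name Q → SetFormula (Name Q)} :
    (p ⊩ .exIn x φ) ↔ Densely p fun r => ∃ z, (r ⊩ .mem z x) ∧ (r ⊩ φ z) := forces_ex

theorem forces_exIn_of {x : Name Q} {φ : Name Q → SetFormula (Name Q)} (z : Name Q)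
    (h : p ⊩ .mem z x) (h' : p ⊩ φ z) : p ⊩ .exIn x φ := forces_ex_of z ⟨h, h'⟩

theorem forces_subset {x y : Name Q} :
    (p ⊩ .subset x y) ↔ ∀ z, ∀ q ≤ p, (q ⊩ .mem z x) → (q ⊩ .mem z y) := forces_allIn

/-! ### Equality -/

theorem forces_eq_refl (x : Name Q) (p : Q) : p ⊩ .eq x x := by
  change forcesEq x x p
  induction x generalizing p with
  | mk ι a c ih =>
    rw [forcesEq]
    exact ⟨fun i t ht r _ hrt => ⟨r, le_rfl, i, ⟨t, ht, hrt⟩, ih i r⟩,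
      fun i t ht r _ hrt => ⟨r, le_rfl, i, ⟨t, ht, hrt⟩, ih i r⟩⟩

theorem Forces.symm {x y : Name Q} (h : p ⊩ .eq x y) : p ⊩ .eq y x := by
  change forcesEq x y p at h
  change forcesEq y x p
  induction x generalizing p y with
  | mk ι a c ih =>
    cases y with
    | mk κ b d =>
      rw [forcesEq] at h ⊢
      refine ⟨fun j t ht r hr hrt => ?_, fun i t ht r hr hrt => ?_⟩
      · obtain ⟨r', hr', i, hi, he⟩ := h.2 j t ht r hr hrt
        exact ⟨r', hr', i, hi, ih i he⟩
      · obtain ⟨r', hr', i, hi, he⟩ := h.1 i t ht r hr hrt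
        exact ⟨r', hr', i, hi, ih _ he⟩

theorem Forces.trans {x y z : Name Q} (h : p ⊩ .eq x y) (h' : p ⊩ .eq y z) : p ⊩ .eq x z := by
  change forcesEq x y p at h
  change forcesEq y z p at h'
  change forcesEq x z p
  induction x generalizing p y z with
  | mk ι a c ih =>
    cases y with
    | mk κ b d =>
      cases z with
      | mk μ e f =>
        rw [forcesEq] at h h' ⊢
        refine ⟨fun i t ht r hr hrt => ?_, fun k t ht r hr hrt => ?_⟩
        · obtain ⟨r₁, h₁, j, ⟨t', ht', hrt'⟩, he⟩ := h.1 i t ht r hr hrt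
          obtain ⟨r₂, h₂, k, hk, he'⟩ := h'.1 j t' ht' r₁ (h₁.trans hr) hrt'
          exact ⟨r₂, h₂.trans h₁, k, hk, ih i (forcesEq_mono he h₂) he'⟩
        · obtain ⟨r₁, h₁, j, ⟨t', ht', hrt'⟩, he⟩ := h'.2 k t ht r hr hrt
          obtain ⟨r₂, h₂, i, hi, he'⟩ := h.2 j t' ht' r₁ (h₁.trans hr) hrt'
          exact ⟨r₂, h₂.trans h₁, i, hi, ih i he' (forcesEq_mono he h₂)⟩

theorem forces_mem_mk {x : Name Q} {ι : Type u} {b : ι → Name Q} {d : ι → Set Q} :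
    (p ⊩ .mem x (.mk ι b d)) ↔
      Densely p fun r => ∃ j, (∃ q ∈ d j, r ≤ q) ∧ (r ⊩ .eq x (b j)) := Iff.rfl

theorem Forces.mem_congr_left {x y z : Name Q} (h : p ⊩ .mem x z) (he : p ⊩ .eq x y) :
    p ⊩ .mem y z := by
  cases z
  rw [forces_mem_mk] at h ⊢
  exact h.imp fun r hr ⟨j, hj, hx⟩ => ⟨j, hj, (he.mono hr).symm.trans hx⟩

theorem Forces.mem_congr_right {x y z : Name Q} (h : p ⊩ .mem z x) (he : p ⊩ .eq x y) :
    p ⊩ .mem z y := by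
  cases x; cases y
  change forcesEq _ _ p at he
  rw [forcesEq] at he
  rw [forces_mem_mk] at h ⊢
  refine h.bind fun r hr ⟨i, ⟨t, ht, hrt⟩, hx⟩ s hs => ?_
  obtain ⟨s', hs', j, hj, hj'⟩ := he.1 i t ht s (hs.trans hr) (hs.trans hrt)
  exact ⟨s', hs', j, hj, (hx.mono (hs'.trans hs)).trans hj'⟩

/-- Extensionality. -/
theorem forces_eq_of_forall_mem {x y : Name Q}
    (h : ∀ z, ∀ q ≤ p, (q ⊩ .mem z x) ↔ (q ⊩ .mem z y)) : p ⊩ .eq x y := by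
  cases x with
  | mk ι a c =>
    cases y with
    | mk κ b d =>
      change forcesEq _ _ p
      rw [forcesEq]
      refine ⟨fun i t ht r hr hrt => ?_, fun j t ht r hr hrt => ?_⟩
      · have := (h (a i) r hr).1 (forces_mem_mk.2 (densely_of_forall fun s hs =>
          ⟨i, ⟨t, ht, hs.trans hrt⟩, forces_eq_refl _ _⟩))
        exact forces_mem_mk.1 this r le_rfl
      · have := (h (b j) r hr).2 (forces_mem_mk.2 (densely_of_forall fun s hs =>
          ⟨j, ⟨t, ht, hs.trans hrt⟩, forces_eq_refl _ _⟩))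
        obtain ⟨r', hr', i, hi, he⟩ := forces_mem_mk.1 this r le_rfl
        exact ⟨r', hr', i, hi, he.symm⟩

/-! ### Formulas that respect equality -/

/-- The truth of `φ x` depends on `x` only up to forced equality. -/
def Respects (φ : Name Q → SetFormula (Name Q)) : Prop :=
  ∀ (p : Q) (x y : Name Q), (p ⊩ .eq x y) → (p ⊩ φ x) → (p ⊩ φ y)

theorem Respects.const (φ : SetFormula (Name Q)) : Respects fun _ : Name Q => φ :=
  fun _ _ _ _ h => h

theorem Respects.mem_right (z : Name Q) : Respects fun x => .mem z x :=
  fun _ _ _ he h => h.mem_congr_right he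

theorem Respects.eq_right (z : Name Q) : Respects fun x => .eq z x :=
  fun _ _ _ he h => h.trans he

theorem Respects.neg {φ : Name Q → SetFormula (Name Q)} (h : Respects φ) :
    Respects fun x => .neg (φ x) :=
  fun _ _ _ he hn q hq hφ => hn q hq (h _ _ _ (he.mono hq).symm hφ)

theorem Respects.and {φ ψ : Name Q → SetFormula (Name Q)} (h : Respects φ) (h' : Respects ψ) :
    Respects fun x => .and (φ x) (ψ x) :=
  fun _ _ _ he hn => ⟨h _ _ _ he hn.1, h' _ _ _ he hn.2⟩

theorem Respects.all {φ : Name Q → Name Q → SetFormula (Name Q)}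
    (h : ∀ z, Respects fun x => φ x z) : Respects fun x => .all (φ x) :=
  fun _ _ _ he hn z => h z _ _ _ he (hn z)

theorem Respects.or {φ ψ : Name Q → SetFormula (Name Q)} (h : Respects φ) (h' : Respects ψ) :
    Respects fun x => .or (φ x) (ψ x) := (h.neg.and h'.neg).neg

theorem Respects.imp {φ ψ : Name Q → SetFormula (Name Q)} (h : Respects φ) (h' : Respects ψ) :
    Respects fun x => .imp (φ x) (ψ x) := (h.and h'.neg).neg

theorem Respects.iff {φ ψ : Name Q → SetFormula (Name Q)} (h : Respects φ) (h' : Respects ψ) :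
    Respects fun x => .iff (φ x) (ψ x) := (h.imp h').and (h'.imp h)

theorem Respects.ex {φ : Name Q → Name Q → SetFormula (Name Q)}
    (h : ∀ z, Respects fun x => φ x z) : Respects fun x => .ex (φ x) :=
  (Respects.all fun z => (h z).neg).neg

/-- The bound `y x` is left general so that it can be either the variable itself or a fixed name. -/
theorem Respects.allIn {φ : Name Q → Name Q → SetFormula (Name Q)} (y : Name Q → Name Q)
    (hy : ∀ z, Respects fun x => .mem z (y x))
    (h : ∀ z, Respects fun x => φ x z) : Respects fun x => .allIn (y x) (φ x) :=
  Respects.all fun z => (hy z).imp (h z)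

theorem Respects.exIn {φ : Name Q → Name Q → SetFormula (Name Q)} (y : Name Q → Name Q)
    (hy : ∀ z, Respects fun x => .mem z (y x))
    (h : ∀ z, Respects fun x => φ x z) : Respects fun x => .exIn (y x) (φ x) :=
  Respects.ex fun z => (hy z).and (h z)

theorem respects_isFIN : Respects fun s : Name Q => .isFIN s :=
  (Respects.allIn _ Respects.mem_right fun k => .const (.isNat k)).and
    ((Respects.ex Respects.mem_right).and
      (Respects.ex fun n => (Respects.const (.isNat n)).and
        (Respects.allIn _ Respects.mem_right fun k => .const (.mem k n))))

theorem respects_inUnions (Y : Name Q) : Respects fun s => .inUnions s Y :=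
  respects_isFIN.and (Respects.allIn _ Respects.mem_right fun _ =>
    Respects.exIn _ (fun _ => .const _) fun _ => (Respects.const _).and
      (Respects.allIn _ (fun _ => .const _) Respects.mem_right))

theorem respects_isUPair_left (x y : Name Q) : Respects fun w => .isUPair w x y :=
  Respects.all fun _ => (Respects.mem_right _).iff (.const _)

theorem respects_isUPair_mid (w y : Name Q) : Respects fun x => .isUPair w x y :=
  Respects.all fun _ => (Respects.const _).iff ((Respects.eq_right _).or (.const _))

theorem respects_isUPair_diag (w : Name Q) : Respects fun x => .isUPair w x x :=
  Respects.all fun _ => (Respects.const _).iff ((Respects.eq_right _).or (.eq_right _))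

theorem respects_isPair_left (x y : Name Q) : Respects fun z => .isPair z x y :=
  Respects.ex fun _ => Respects.ex fun _ => (Respects.const _).and
    ((Respects.const _).and (respects_isUPair_left _ _))

theorem respects_isPair_mid (z y : Name Q) : Respects fun x => .isPair z x y :=
  Respects.ex fun _ => Respects.ex fun _ => (respects_isUPair_diag _).and
    ((respects_isUPair_mid _ _).and (.const _))

theorem respects_pairIn_mid (f y : Name Q) : Respects fun x => .pairIn f x y :=
  Respects.exIn _ (fun _ => .const _) fun _ => respects_isPair_mid _ _

/-! ### Pairs -/

theorem forces_isUPair {w x y : Name Q} : (p ⊩ .isUPair w x y) ↔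
    ∀ v, ∀ q ≤ p, (q ⊩ .mem v w) ↔ Densely q fun r => (r ⊩ .eq v x) ∨ (r ⊩ .eq v y) := by
  rw [SetFormula.isUPair, forces_all]
  refine forall_congr' fun v => ?_
  rw [forces_iff]
  exact forall₂_congr fun q _ => by rw [forces_or]

theorem forces_isUPair_left_mem {w x y : Name Q} (h : p ⊩ .isUPair w x y) : p ⊩ .mem x w :=
  (forces_isUPair.1 h x p le_rfl).2 (densely_of_forall fun _ _ => .inl (forces_eq_refl _ _))

theorem forces_isUPair_right_mem {w x y : Name Q} (h : p ⊩ .isUPair w x y) : p ⊩ .mem y w :=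
  (forces_isUPair.1 h y p le_rfl).2 (densely_of_forall fun _ _ => .inr (forces_eq_refl _ _))

theorem forces_isUPair_mem {w x y v : Name Q} (h : p ⊩ .isUPair w x y) (hv : p ⊩ .mem v w) :
    Densely p fun r => (r ⊩ .eq v x) ∨ (r ⊩ .eq v y) :=
  (forces_isUPair.1 h v p le_rfl).1 hv

theorem forces_eq_of_isUPair_self {w x v : Name Q} (h : p ⊩ .isUPair w x x)
    (hv : p ⊩ .mem v w) : p ⊩ .eq v x :=
  (forces_isUPair_mem h hv).forces fun _ _ h => h.elim id id

theorem forces_isPair {z x y : Name Q} : (p ⊩ .isPair z x y) ↔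
    Densely p fun r => ∃ a b, (r ⊩ .isUPair a x x) ∧ (r ⊩ .isUPair b x y) ∧
      (r ⊩ .isUPair z a b) := by
  rw [SetFormula.isPair, forces_ex]
  refine ⟨fun h => h.bind fun r _ ⟨a, ha⟩ => (forces_ex.1 ha).imp fun r' _ ⟨b, hb⟩ =>
    ⟨a, b, hb.1, hb.2.1, hb.2.2⟩, fun h => h.imp fun r _ ⟨a, b, h₁, h₂, h₃⟩ =>
    ⟨a, forces_ex_of b ⟨h₁, h₂, h₃⟩⟩⟩

theorem forces_isPair_inj_left {z x y x' y' : Name Q} (h : p ⊩ .isPair z x y)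
    (h' : p ⊩ .isPair z x' y') : p ⊩ .eq x x' := by
  refine (forces_isPair.1 h).forces fun r₁ hr₁ ⟨a, b, ha, hb, hz⟩ => ?_
  refine (forces_isPair.1 (h'.mono hr₁)).forces fun r₂ hr₂ ⟨a', b', ha', hb', hz'⟩ => ?_
  replace ha := ha.mono hr₂
  replace hz := hz.mono hr₂
  refine (forces_isUPair_mem hz' (forces_isUPair_left_mem hz)).forces fun r hr h => ?_
  rcases h with h | h
  · exact forces_eq_of_isUPair_self (ha'.mono hr)
      ((forces_isUPair_left_mem (ha.mono hr)).mem_congr_right h)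
  · exact (forces_eq_of_isUPair_self (ha.mono hr)
      ((forces_isUPair_left_mem (hb'.mono hr)).mem_congr_right h.symm)).symm

theorem forces_isPair_inj_right {z x y x' y' : Name Q} (h : p ⊩ .isPair z x y)
    (h' : p ⊩ .isPair z x' y') : p ⊩ .eq y y' := by
  have hx := forces_isPair_inj_left h h'
  refine (forces_isPair.1 h).forces fun r₁ hr₁ ⟨a, b, ha, hb, hz⟩ => ?_
  refine (forces_isPair.1 (h'.mono hr₁)).forces fun r₂ hr₂ ⟨a', b', ha', hb', hz'⟩ => ?_
  replace ha := ha.mono hr₂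
  replace hb := hb.mono hr₂
  replace hz := hz.mono hr₂
  replace hx := hx.mono (hr₂.trans hr₁)
  refine (forces_isUPair_mem hz' (forces_isUPair_right_mem hz)).forces fun r₃ hr₃ h => ?_
  refine (forces_isUPair_mem (hz.mono hr₃) ((forces_isUPair_right_mem hz').mono hr₃)).forces
    fun r₄ hr₄ h₁ => ?_
  replace ha := ha.mono (hr₄.trans hr₃)
  replace hb := hb.mono (hr₄.trans hr₃)
  replace ha' := ha'.mono (hr₄.trans hr₃)
  replace hb' := hb'.mono (hr₄.trans hr₃)
  replace hx := hx.mono (hr₄.trans hr₃)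
  have hy := forces_isUPair_right_mem hb
  have hy' := forces_isUPair_right_mem hb'
  -- Here `b = {x, y}` equals `{x'}` or `{x', y'}`. In the degenerate case `y = x'`, and `y'` is
  -- equal to `x` or to `x'`, which agree. Otherwise `y ∈ {x', y'}` and `y' ∈ {x, y}`, and the only
  -- case without an immediate equality is `y = x'`, `y' = x`, where `x = x'` helps.
  rcases h with h | h
  · replace h := h.mono hr₄
    have hyx := forces_eq_of_isUPair_self ha' (hy.mem_congr_right h)
    rcases h₁ with h₁ | h₁
    · exact hyx.trans (hx.symm.trans
        (forces_eq_of_isUPair_self ha (hy'.mem_congr_right h₁)).symm)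
    · exact hyx.trans
        (forces_eq_of_isUPair_self ha' (hy'.mem_congr_right (h₁.trans h))).symm
  · replace h := h.mono hr₄
    refine (forces_isUPair_mem hb' (hy.mem_congr_right h)).forces fun r₅ hr₅ h₂ => ?_
    refine (forces_isUPair_mem (hb.mono hr₅) ((hy'.mem_congr_right h.symm).mono hr₅)).forces
      fun r₆ hr₆ h₃ => ?_
    rcases h₂ with h₂ | h₂
    · rcases h₃ with h₃ | h₃
      · exact (h₂.mono hr₆).trans ((hx.mono (hr₆.trans hr₅)).symm.trans h₃.symm)
      · exact h₃.symm
    · exact h₂.mono hr₆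

end ForcingBasics

/-! ### Canonical names -/

section CheckNames

variable {Q : Type u} [Preorder Q] {p q : Q}

theorem forces_check_eq {x y : PSet.{u}} (h : x.Equiv y) (p : Q) :
    p ⊩ .eq (check Q x) (check Q y) := by
  change forcesEq _ _ p
  induction x generalizing y p with
  | mk ι a ih =>
    cases y with
    | mk κ b =>
      rw [check, check, forcesEq]
      refine ⟨fun i t _ r _ _ => ?_, fun j t _ r _ _ => ?_⟩
      · obtain ⟨j, hj⟩ := h.1 i
        exact ⟨r, le_rfl, j, ⟨r, trivial, le_rfl⟩, ih i hj r⟩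
      · obtain ⟨i, hi⟩ := h.2 j
        exact ⟨r, le_rfl, i, ⟨r, trivial, le_rfl⟩, ih i hi r⟩

theorem equiv_of_forces_check_eq {x y : PSet.{u}} (h : p ⊩ .eq (check Q x) (check Q y)) :
    x.Equiv y := by
  change forcesEq _ _ p at h
  induction x generalizing y p with
  | mk ι a ih =>
    cases y with
    | mk κ b =>
      rw [check, check, forcesEq] at h
      refine ⟨fun i => ?_, fun j => ?_⟩
      · obtain ⟨r, _, j, _, he⟩ := h.1 i p trivial p le_rfl le_rfl
        exact ⟨j, ih i he⟩
      · obtain ⟨r, _, i, _, he⟩ := h.2 j p trivial p le_rfl le_rfl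
        exact ⟨i, ih i he⟩

theorem forces_mem_check {x : PSet.{u}} {z : Name Q} :
    (p ⊩ .mem z (check Q x)) ↔ Densely p fun r => ∃ w ∈ x, r ⊩ .eq z (check Q w) := by
  cases x with
  | mk ι a =>
    rw [check, forces_mem_mk]
    refine ⟨fun h => h.imp fun r _ ⟨j, _, hj⟩ => ⟨a j, PSet.Mem.mk a j, hj⟩,
      fun h => h.imp fun r _ ⟨w, ⟨j, hj⟩, hw⟩ =>
        ⟨j, ⟨r, trivial, le_rfl⟩, hw.trans (forces_check_eq hj r)⟩⟩

theorem forces_check_mem {x y : PSet.{u}} (h : x ∈ y) (p : Q) :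
    p ⊩ .mem (check Q x) (check Q y) :=
  forces_mem_check.2 (densely_of_forall fun _ _ => ⟨x, h, forces_eq_refl _ _⟩)

theorem mem_of_forces_check_mem {x y : PSet.{u}} (h : p ⊩ .mem (check Q x) (check Q y)) :
    x ∈ y := by
  obtain ⟨r, _, w, hw, he⟩ := (forces_mem_check.1 h).exists
  exact (PSet.Mem.congr_left (equiv_of_forces_check_eq he)).2 hw

/-! ### Natural numbers in the ground model and in the extension -/

theorem mem_ofNat {n : ℕ} {w : PSet.{u}} :
    w ∈ PSet.ofNat n ↔ ∃ m < n, w.Equiv (PSet.ofNat.{u} m) := by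
  induction n with
  | zero => simp [PSet.ofNat, PSet.notMem_empty]
  | succ n ih =>
    rw [PSet.ofNat, PSet.mem_insert_iff, ih]
    constructor
    · rintro (h | ⟨m, hm, h⟩)
      · exact ⟨n, n.lt_succ_self, h⟩
      · exact ⟨m, hm.trans n.lt_succ_self, h⟩
    · rintro ⟨m, hm, h⟩
      rcases Nat.lt_succ_iff_lt_or_eq.1 hm with hm | rfl
      · exact .inr ⟨m, hm, h⟩
      · exact .inl h

theorem ofNat_injective {m n : ℕ} (h : (PSet.ofNat.{u} m).Equiv (PSet.ofNat.{u} n)) : m = n := by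
  by_contra hne
  rcases Nat.lt_or_gt_of_ne hne with hlt | hlt
  · exact PSet.mem_irrefl _ ((PSet.Mem.congr_right h).2 (mem_ofNat.2 ⟨m, hlt, .refl _⟩))
  · exact PSet.mem_irrefl _ ((PSet.Mem.congr_right h).1 (mem_ofNat.2 ⟨n, hlt, .refl _⟩))

theorem ofNat_mem_ofNat {m n : ℕ} : PSet.ofNat.{u} m ∈ PSet.ofNat.{u} n ↔ m < n := by
  rw [mem_ofNat]
  exact ⟨fun ⟨k, hk, h⟩ => ofNat_injective h ▸ hk, fun h => ⟨m, h, .refl _⟩⟩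

theorem mem_omega {w : PSet.{u}} : w ∈ PSet.omega ↔ ∃ n, w.Equiv (PSet.ofNat.{u} n) :=
  ⟨fun ⟨n, h⟩ => ⟨n.down, h⟩, fun ⟨n, h⟩ => ⟨⟨n⟩, h⟩⟩

variable (Q) in
/-- The canonical name of a natural number. -/
abbrev natName (n : ℕ) : Name Q := check Q (PSet.ofNat n)

theorem forces_mem_natName {n : ℕ} {z : Name Q} :
    (p ⊩ .mem z (natName Q n)) ↔ Densely p fun r => ∃ m < n, r ⊩ .eq z (natName Q m) := by
  rw [forces_mem_check]
  refine ⟨fun h => h.imp fun r _ ⟨w, hw, he⟩ => ?_, fun h => h.imp fun r _ ⟨m, hm, he⟩ =>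
    ⟨_, ofNat_mem_ofNat.2 hm, he⟩⟩
  obtain ⟨m, hm, h'⟩ := mem_ofNat.1 hw
  exact ⟨m, hm, he.trans (forces_check_eq h' r)⟩

theorem forces_isEmpty_natName_zero (p : Q) : p ⊩ .isEmpty (natName Q 0) := by
  intro z r _ h
  obtain ⟨_, _, m, hm, _⟩ := (forces_mem_natName.1 h).exists
  exact absurd hm (Nat.not_lt_zero m)

theorem forces_isSucc {x y : Name Q} : (p ⊩ .isSucc y x) ↔
    ∀ z, ∀ q ≤ p, (q ⊩ .mem z y) ↔ Densely q fun r => (r ⊩ .mem z x) ∨ (r ⊩ .eq z x) := by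
  rw [SetFormula.isSucc, forces_all]
  refine forall_congr' fun v => ?_
  rw [forces_iff]
  exact forall₂_congr fun q _ => by rw [forces_or]

theorem forces_isSucc_natName (n : ℕ) (p : Q) :
    p ⊩ .isSucc (natName Q (n + 1)) (natName Q n) := by
  refine forces_isSucc.2 fun z q _ => ⟨fun h => ?_, fun h => h.forces fun r _ h => ?_⟩
  · refine (forces_mem_natName.1 h).imp fun r _ ⟨m, hm, he⟩ => ?_
    rcases Nat.lt_succ_iff_lt_or_eq.1 hm with hm | rfl
    · exact .inl (forces_mem_natName.2 (densely_of_forall fun s hs => ⟨m, hm, he.mono hs⟩))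
    · exact .inr he
  · rcases h with h | h
    · exact forces_mem_natName.2 ((forces_mem_natName.1 h).imp fun _ _ ⟨m, hm, he⟩ =>
        ⟨m, hm.trans n.lt_succ_self, he⟩)
    · exact forces_mem_natName.2 (densely_of_forall fun s hs =>
        ⟨n, n.lt_succ_self, h.mono hs⟩)

theorem respects_isSucc_right (y : Name Q) : Respects fun x => .isSucc y x :=
  Respects.all fun _ => (Respects.const _).iff ((Respects.mem_right _).or (.eq_right _))

theorem forces_isInductive_omega (p : Q) : p ⊩ .isInductive (check Q PSet.omega) := by
  refine ⟨forces_exIn_of (natName Q 0) (forces_check_mem (mem_omega.2 ⟨0, .refl _⟩) p)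
    (forces_isEmpty_natName_zero p), forces_allIn.2 fun x q _ hx => ?_⟩
  refine (forces_mem_check.1 hx).forces fun r _ ⟨w, hw, he⟩ => ?_
  obtain ⟨n, hn⟩ := mem_omega.1 hw
  exact forces_exIn_of (natName Q (n + 1)) (forces_check_mem (mem_omega.2 ⟨n + 1, .refl _⟩) r)
    (respects_isSucc_right _ _ _ _ (he.trans (forces_check_eq hn r)).symm
      (forces_isSucc_natName n r))

/-- No new natural numbers appear. The canonical name of `ω` is forced to be inductive, which bounds
the numbers of the extension. Conversely, induction in the ground model puts each `n` into every
inductive name, by extensionality for `∅` and successors. -/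
theorem forces_isNat {x : Name Q} :
    (p ⊩ .isNat x) ↔ Densely p fun r => ∃ n, r ⊩ .eq x (natName Q n) := by
  constructor
  · intro h
    have := forces_imp.1 (h (check Q PSet.omega)) p le_rfl (forces_isInductive_omega p)
    refine (forces_mem_check.1 this).imp fun r _ ⟨w, hw, he⟩ => ?_
    obtain ⟨n, hn⟩ := mem_omega.1 hw
    exact ⟨n, he.trans (forces_check_eq hn r)⟩
  · intro h
    refine fun I => forces_imp.2 fun q hq hI => (h.mono hq).forces fun r hr ⟨n, hn⟩ => ?_
    refine Forces.mem_congr_left ?_ hn.symm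
    replace hI := hI.mono hr
    clear hn
    induction n with
    | zero =>
      refine (forces_exIn.1 hI.1).forces fun s _ ⟨e, heI, he⟩ => heI.mem_congr_left ?_
      refine forces_eq_of_forall_mem fun z t ht => ⟨fun hz => absurd hz (he z t ht),
        fun hz => absurd hz (forces_isEmpty_natName_zero s z t ht)⟩
    | succ n ih =>
      refine (forces_exIn.1 (forces_allIn.1 hI.2 _ r le_rfl ih)).forces
        fun s _ ⟨y, hyI, hy⟩ => hyI.mem_congr_left ?_
      exact forces_eq_of_forall_mem fun z t ht => (forces_isSucc.1 hy z t ht).trans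
        (forces_isSucc.1 (forces_isSucc_natName n s) z t ht).symm

theorem forces_isNat_natName (n : ℕ) (p : Q) : p ⊩ .isNat (natName Q n) :=
  forces_isNat.2 (densely_of_forall fun _ _ => ⟨n, forces_eq_refl _ _⟩)

theorem forces_isTwo_codeBool (t : Bool) (p : Q) : p ⊩ .isTwo (check Q (codeBool t)) := by
  refine forces_or.2 (densely_of_forall fun r _ => ?_)
  cases t with
  | false => exact .inl (forces_isEmpty_natName_zero r)
  | true =>
    exact .inr (forces_ex_of (natName Q 0)
      ⟨forces_isEmpty_natName_zero r, forces_isSucc_natName 0 r⟩)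

theorem codeBool_injective {t t' : Bool} (h : (codeBool.{u} t).Equiv (codeBool.{u} t')) : t = t' := by
  have h := ofNat_injective h
  revert h
  cases t <;> cases t' <;> simp

/-! ### Canonical names of finite sets -/

theorem mem_codeFIN {s : FIN} {w : PSet.{u}} :
    w ∈ codeFIN s ↔ ∃ n ∈ s.1, w.Equiv (PSet.ofNat.{u} n) :=
  ⟨fun ⟨n, h⟩ => ⟨n.down.1, n.down.2, h⟩, fun ⟨n, hn, h⟩ => ⟨⟨⟨n, hn⟩⟩, h⟩⟩

theorem ofNat_mem_codeFIN {s : FIN} {n : ℕ} : PSet.ofNat.{u} n ∈ codeFIN.{u} s ↔ n ∈ s.1 := by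
  rw [mem_codeFIN]
  exact ⟨fun ⟨k, hk, h⟩ => ofNat_injective h ▸ hk, fun h => ⟨n, h, .refl _⟩⟩

theorem codeFIN_injective {s t : FIN} (h : (codeFIN.{u} s).Equiv (codeFIN.{u} t)) : s = t := by
  ext n
  rw [← ofNat_mem_codeFIN.{u}, ← ofNat_mem_codeFIN.{u}]
  exact PSet.Mem.congr_right h

theorem mem_codeSet {A : Set FIN} {w : PSet.{u}} :
    w ∈ codeSet A ↔ ∃ s ∈ A, w.Equiv (codeFIN.{u} s) :=
  ⟨fun ⟨s, h⟩ => ⟨s.down.1, s.down.2, h⟩, fun ⟨s, hs, h⟩ => ⟨⟨⟨s, hs⟩⟩, h⟩⟩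

theorem mem_codeUltrafilter {H : Ultrafilter FIN} {w : PSet.{u}} :
    w ∈ codeUltrafilter H ↔ ∃ A ∈ H, w.Equiv (codeSet.{u} A) :=
  ⟨fun ⟨A, h⟩ => ⟨A.down.1, A.down.2, h⟩, fun ⟨A, hA, h⟩ => ⟨⟨⟨A, hA⟩⟩, h⟩⟩

variable (Q) in
/-- The canonical name of an element of `FIN`. -/
abbrev finName (s : FIN) : Name Q := check Q (codeFIN s)

theorem forces_mem_finName {s : FIN} {z : Name Q} :
    (p ⊩ .mem z (finName Q s)) ↔ Densely p fun r => ∃ n ∈ s.1, r ⊩ .eq z (natName Q n) := by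
  rw [forces_mem_check]
  refine ⟨fun h => h.imp fun r _ ⟨w, hw, he⟩ => ?_, fun h => h.imp fun r _ ⟨m, hm, he⟩ =>
    ⟨_, ofNat_mem_codeFIN.2 hm, he⟩⟩
  obtain ⟨m, hm, h'⟩ := mem_codeFIN.1 hw
  exact ⟨m, hm, he.trans (forces_check_eq h' r)⟩

theorem forces_mem_codeSet {A : Set FIN} {z : Name Q} :
    (p ⊩ .mem z (check Q (codeSet A))) ↔
      Densely p fun r => ∃ s ∈ A, r ⊩ .eq z (finName Q s) := by
  rw [forces_mem_check]
  refine ⟨fun h => h.imp fun r _ ⟨w, hw, he⟩ => ?_, fun h => h.imp fun r _ ⟨s, hs, he⟩ =>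
    ⟨_, mem_codeSet.2 ⟨s, hs, .refl _⟩, he⟩⟩
  obtain ⟨m, hm, h'⟩ := mem_codeSet.1 hw
  exact ⟨m, hm, he.trans (forces_check_eq h' r)⟩

theorem forces_isFIN_finName (s : FIN) (p : Q) : p ⊩ .isFIN (finName Q s) := by
  refine ⟨forces_allIn.2 fun z q _ hz => ?_, ?_, ?_⟩
  · exact forces_isNat.2 ((forces_mem_finName.1 hz).imp fun _ _ ⟨n, _, h⟩ => ⟨n, h⟩)
  · obtain ⟨n, hn⟩ := s.2
    exact forces_ex_of (natName Q n) (forces_check_mem (ofNat_mem_codeFIN.2 hn) p)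
  · refine forces_ex_of (natName Q (s.max + 1)) ⟨forces_isNat_natName _ p,
      forces_allIn.2 fun z q _ hz => ?_⟩
    exact forces_mem_natName.2 ((forces_mem_finName.1 hz).imp fun _ _ ⟨n, hn, h⟩ =>
      ⟨n, Nat.lt_succ_of_le (s.1.le_max' n hn), h⟩)

/-- The members of a name below a natural number can be decided. -/
theorem densely_decides_members (x : Name Q) (m : ℕ) (p : Q) :
    Densely p fun r => ∃ A : Finset ℕ, ∀ i < m,
      (i ∈ A → r ⊩ .mem (natName Q i) x) ∧ (i ∉ A → r ⊩ .neg (.mem (natName Q i) x)) := by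
  induction m with
  | zero => exact densely_of_forall fun r _ => ⟨∅, fun i hi => absurd hi (Nat.not_lt_zero i)⟩
  | succ m ih =>
    refine ih.bind fun r _ ⟨A, hA⟩ s hs => ?_
    -- If no extension of `s` forces `m` into `x`, then `s` itself already forces `m` out of `x`.
    by_cases hm : ∃ t ≤ s, t ⊩ .mem (natName Q m) x
    · obtain ⟨t, ht, hm⟩ := hm
      refine ⟨t, ht, insert m A, fun i hi => ?_⟩
      rcases Nat.lt_succ_iff_lt_or_eq.1 hi with hi | rfl
      · have := hA i hi
        rw [Finset.mem_insert, or_iff_right hi.ne]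
        exact ⟨fun h => (this.1 h).mono (ht.trans hs), fun h => (this.2 h).mono (ht.trans hs)⟩
      · exact ⟨fun _ => hm, fun h => absurd (Finset.mem_insert_self _ _) h⟩
    · refine ⟨s, le_rfl, A.erase m, fun i hi => ?_⟩
      rcases Nat.lt_succ_iff_lt_or_eq.1 hi with hi | rfl
      · have := hA i hi
        rw [Finset.mem_erase, and_iff_right hi.ne]
        exact ⟨fun h => (this.1 h).mono hs, fun h => (this.2 h).mono hs⟩
      · exact ⟨fun h => absurd h (Finset.notMem_erase _ _),
          fun _ t ht h => hm ⟨t, ht, h⟩⟩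

/-- Finite sets are absolute: once a bound `N` is decided, deciding finitely many memberships
determines the set. -/
theorem forces_isFIN {x : Name Q} :
    (p ⊩ .isFIN x) ↔ Densely p fun r => ∃ s, r ⊩ .eq x (finName Q s) := by
  refine ⟨fun h => ?_, fun h => h.forces fun r _ ⟨s, hs⟩ =>
    respects_isFIN _ _ _ hs.symm (forces_isFIN_finName s r)⟩
  refine (forces_ex.1 h.2.2).bind fun r₁ hr₁ ⟨n, hn, hxn⟩ => ?_
  refine (forces_isNat.1 hn).bind fun r₂ hr₂ ⟨N, hN⟩ => ?_
  refine (forces_ex.1 (h.2.1.mono (hr₂.trans hr₁))).bind fun r₃ hr₃ ⟨k, hk⟩ => ?_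
  refine (densely_decides_members x N r₃).imp fun r hr ⟨A, hA⟩ => ?_
  have hmem : ∀ z, ∀ t ≤ r, (t ⊩ .mem z x) →
      Densely t fun t' => ∃ i ∈ A.filter (· < N), t' ⊩ .eq z (natName Q i) := by
    intro z t ht hz
    have hz' := (forces_allIn.1 hxn z t (ht.trans (hr.trans (hr₃.trans hr₂))) hz).mem_congr_right
      (hN.mono (ht.trans (hr.trans hr₃)))
    refine (forces_mem_natName.1 hz').imp fun t' ht' ⟨i, hi, he⟩ => ⟨i, ?_, he⟩
    rw [Finset.mem_filter]
    refine ⟨?_, hi⟩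
    by_contra hiA
    exact (hA i hi).2 hiA t' (ht'.trans ht) ((hz.mono ht').mem_congr_left he)
  have hne : (A.filter (· < N)).Nonempty := by
    obtain ⟨_, _, i, hi, _⟩ := (hmem k r le_rfl (hk.mono hr)).exists
    exact ⟨i, hi⟩
  refine ⟨⟨A.filter (· < N), hne⟩, forces_eq_of_forall_mem fun z t ht =>
    ⟨fun hz => forces_mem_finName.2 (hmem z t ht hz), fun hz => ?_⟩⟩
  refine (forces_mem_finName.1 hz).forces fun t' ht' ⟨i, hi, he⟩ => ?_
  have hi' := Finset.mem_filter.1 hi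
  exact (((hA i hi'.2).1 hi'.1).mono (ht'.trans ht)).mem_congr_left he.symm

theorem forces_blk_finName {s t : FIN} (h : p ⊩ .blk (finName Q s) (finName Q t)) : Blk s t := by
  have h₁ := forces_allIn.1 h (natName Q s.max) p le_rfl
    (forces_check_mem (ofNat_mem_codeFIN.2 (s.1.max'_mem s.2)) p)
  have h₂ := forces_allIn.1 h₁ (natName Q t.min) p le_rfl
    (forces_check_mem (ofNat_mem_codeFIN.2 (t.1.min'_mem t.2)) p)
  exact ofNat_mem_ofNat.1 (mem_of_forces_check_mem h₂)

theorem respects_blk_right (s : Name Q) : Respects fun t => .blk s t :=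
  Respects.allIn (φ := fun t i => .allIn t fun j => .mem i j) _ (fun _ => .const _)
    fun i => Respects.allIn _ Respects.mem_right fun j => .const (.mem i j)

/-! ### Names of functions -/

theorem forces_isUPair_check {w x y : PSet.{u}} (h : ∀ v, v ∈ w ↔ v.Equiv x ∨ v.Equiv y)
    (p : Q) : p ⊩ .isUPair (check Q w) (check Q x) (check Q y) := by
  refine forces_isUPair.2 fun v q _ => ⟨fun hv => ?_, fun hv => ?_⟩
  · refine (forces_mem_check.1 hv).imp fun r _ ⟨v', hv', he⟩ => ?_
    exact ((h v').1 hv').imp (fun h' => he.trans (forces_check_eq h' r))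
      fun h' => he.trans (forces_check_eq h' r)
  · refine forces_mem_check.2 (hv.imp fun r _ hv => ?_)
    rcases hv with hv | hv
    · exact ⟨x, (h x).2 (.inl (.refl _)), hv⟩
    · exact ⟨y, (h y).2 (.inr (.refl _)), hv⟩

theorem forces_isPair_check (x y : PSet.{u}) (p : Q) :
    p ⊩ .isPair (check Q (codePair x y)) (check Q x) (check Q y) :=
  forces_ex_of (check Q {x}) <| forces_ex_of (check Q {x, y})
    ⟨forces_isUPair_check (by simp) p, forces_isUPair_check (fun _ => PSet.mem_pair) p,
      forces_isUPair_check (fun _ => PSet.mem_pair) p⟩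

/-- The name of a relation between two families of sets of the ground model: the pair `(a i, b j)`
is put into it by the conditions in `cond i j`. -/
def relName {A B : Type} (a : A → PSet.{u}) (b : B → PSet.{u}) (cond : A → B → Set Q) : Name Q :=
  .mk (ULift.{u} (A × B)) (fun x => check Q (codePair (a x.down.1) (b x.down.2)))
    (fun x => cond x.down.1 x.down.2)

section RelName

variable {A B : Type} {a : A → PSet.{u}} {b : B → PSet.{u}} {cond : A → B → Set Q}

theorem forces_mem_relName {z : Name Q} : (p ⊩ .mem z (relName a b cond)) ↔
    Densely p fun r => ∃ i j, (∃ q ∈ cond i j, r ≤ q) ∧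
      (r ⊩ .eq z (check Q (codePair (a i) (b j)))) := by
  rw [relName, forces_mem_mk]
  exact ⟨fun h => h.imp fun r _ ⟨j, hj, he⟩ => ⟨j.down.1, j.down.2, hj, he⟩,
    fun h => h.imp fun r _ ⟨i, j, hj, he⟩ => ⟨⟨(i, j)⟩, hj, he⟩⟩

theorem forces_pairIn_relName_of {i : A} {j : B} (hq : q ∈ cond i j) (hp : p ≤ q) :
    p ⊩ .pairIn (relName a b cond) (check Q (a i)) (check Q (b j)) :=
  forces_exIn_of (check Q (codePair (a i) (b j)))
    (forces_mem_relName.2 (densely_of_forall fun _ hr =>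
      ⟨i, j, ⟨q, hq, hr.trans hp⟩, forces_eq_refl _ _⟩))
    (forces_isPair_check _ _ p)

theorem densely_of_forces_pairIn_relName (ha : ∀ i i', (a i).Equiv (a i') → i = i') {i : A}
    {y : Name Q} (h : p ⊩ .pairIn (relName a b cond) (check Q (a i)) y) :
    Densely p fun r => ∃ j, (∃ q ∈ cond i j, r ≤ q) ∧ (r ⊩ .eq y (check Q (b j))) := by
  refine (forces_exIn.1 h).bind fun r hr ⟨z, hz, hp⟩ => ?_
  refine (forces_mem_relName.1 hz).imp fun s hs ⟨i', j, hj, he⟩ => ?_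
  have h₁ := respects_isPair_left _ _ _ _ _ he (hp.mono hs)
  have h₂ := forces_isPair_check (a i') (b j) s
  obtain rfl := ha _ _ (equiv_of_forces_check_eq (forces_isPair_inj_left h₁ h₂))
  exact ⟨j, hj, forces_isPair_inj_right h₁ h₂⟩

/-- This serves both for the function on `ω` to which boundedness is applied and for the generic
colouring. It reduces functionality of a name to two facts about conditions: some value is reached
densely, and no condition lies below two different values. -/
theorem forces_isFun_relName {D R : Name Q → SetFormula (Name Q)}
    (ha : ∀ i i', (a i).Equiv (a i') → i = i')
    (hD : ∀ q ≤ p, ∀ x, (q ⊩ D x) → Densely q fun r => ∃ i, r ⊩ .eq x (check Q (a i)))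
    (hDa : ∀ i, p ⊩ D (check Q (a i))) (hRb : ∀ j, p ⊩ R (check Q (b j)))
    (htot : ∀ i, Densely p fun r => ∃ j, ∃ q ∈ cond i j, r ≤ q)
    (huniq : ∀ i j j' r, r ≤ p → (∃ q ∈ cond i j, r ≤ q) → (∃ q ∈ cond i j', r ≤ q) → j = j') :
    p ⊩ .isFun D R (relName a b cond) := by
  refine ⟨forces_allIn.2 fun z q hq hz => ?_, fun x => forces_imp.2 fun q hq hx => ?_⟩
  · refine (forces_mem_relName.1 hz).forces fun r hr ⟨i, j, _, he⟩ => ?_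
    exact forces_ex_of (check Q (a i)) <| forces_ex_of (check Q (b j))
      ⟨(hDa i).mono (hr.trans hq), (hRb j).mono (hr.trans hq),
        respects_isPair_left _ _ _ _ _ he.symm (forces_isPair_check _ _ r)⟩
  · refine (hD q hq x hx).forces fun r hr ⟨i, he⟩ => ?_
    refine ((htot i).mono (hr.trans hq)).forces fun s hs ⟨j, hj⟩ => ?_
    refine forces_ex_of (check Q (b j)) ⟨?_, fun y' => forces_imp.2 fun t ht h => ?_⟩
    · obtain ⟨q', hq', hs'⟩ := hj
      exact respects_pairIn_mid _ _ _ _ _ (he.mono hs).symm (forces_pairIn_relName_of hq' hs')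
    · have h' := respects_pairIn_mid _ _ _ _ _ (he.mono (ht.trans hs)) h
      refine (densely_of_forces_pairIn_relName ha h').forces fun t' ht' ⟨j', hj', he'⟩ => ?_
      obtain rfl := huniq i j' j t' (ht'.trans (ht.trans (hs.trans (hr.trans hq)))) hj' (by
        obtain ⟨q', hq', hs'⟩ := hj
        exact ⟨q', hq', ht'.trans (ht.trans hs')⟩)
      exact he'

end RelName

end CheckNames

/-! ### Block sequences and ordered-union ultrafilters -/

theorem FIN.max_mem (s : FIN) : s.max ∈ s.1 := s.1.max'_mem s.2

theorem FIN.min_mem (s : FIN) : s.min ∈ s.1 := s.1.min'_mem s.2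

theorem FIN.le_max {s : FIN} {n : ℕ} (h : n ∈ s.1) : n ≤ s.max := s.1.le_max' n h

theorem FIN.min_le {s : FIN} {n : ℕ} (h : n ∈ s.1) : s.min ≤ n := s.1.min'_le n h

theorem FIN.min_le_max (s : FIN) : s.min ≤ s.max := FIN.le_max s.min_mem

/-- The union of two elements of `FIN`. -/
def FIN.union (s t : FIN) : FIN := ⟨s.1 ∪ t.1, s.2.mono Finset.subset_union_left⟩

theorem FIN.mem_union {s t : FIN} {n : ℕ} : n ∈ (s.union t).1 ↔ n ∈ s.1 ∨ n ∈ t.1 :=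
  Finset.mem_union

theorem IsBlockSeq.max_injOn {X : Set FIN} (hX : IsBlockSeq X) : Set.InjOn FIN.max X := by
  intro s hs t ht h
  rcases hX.2 s hs t ht with h' | h' | h'
  · exact h'
  · have := t.min_le_max
    unfold Blk at h'
    omega
  · have := s.min_le_max
    unfold Blk at h'
    omega

theorem IsBlockSeq.min_injOn {X : Set FIN} (hX : IsBlockSeq X) : Set.InjOn FIN.min X := by
  intro s hs t ht h
  rcases hX.2 s hs t ht with h' | h' | h'
  · exact h'
  · have := s.min_le_max
    unfold Blk at h'
    omega
  · have := t.min_le_max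
    unfold Blk at h'
    omega

theorem IsInfBlockSeq.exists_le_min {X : Set FIN} (hX : IsInfBlockSeq X) (N : ℕ) :
    ∃ x ∈ X, N ≤ x.min := by
  by_contra! h
  exact hX.2 (Set.Finite.of_injOn (f := FIN.min) (t := Set.Iio N) (fun x hx => h x hx)
    hX.1.min_injOn (Set.finite_Iio N))

theorem subset_unions (X : Set FIN) : X ⊆ unions X := fun x hx =>
  ⟨{x}, by simpa using hx, ⟨⟨x, by simp⟩, by simp⟩, by simp⟩

/-- Only finitely many members of `X` lie inside the finite set `s`, so they form the required
finite sequence. The pointwise description makes closure under unions and transitivity of `[·]`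
immediate. -/
theorem mem_unions_iff {X : Set FIN} (hX : IsBlockSeq X) {s : FIN} :
    s ∈ unions X ↔ ∀ n ∈ s.1, ∃ t ∈ X, n ∈ t.1 ∧ t.1 ⊆ s.1 := by
  constructor
  · rintro ⟨F, hF, -, hs⟩ n hn
    rw [hs, Finset.mem_biUnion] at hn
    obtain ⟨t, ht, hnt⟩ := hn
    exact ⟨t, hF ht, hnt, hs ▸ Finset.subset_biUnion_of_mem Subtype.val ht⟩
  · intro h
    have hfin : {t : FIN | t ∈ X ∧ t.1 ⊆ s.1}.Finite :=
      Set.Finite.of_injOn (f := Subtype.val) (t := (s.1.powerset : Set (Finset ℕ)))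
        (fun t ht => by simpa using ht.2) Subtype.val_injective.injOn (Finset.finite_toSet _)
    refine ⟨hfin.toFinset, fun t ht => (by simpa using ht : t ∈ X ∧ t.1 ⊆ s.1).1, ⟨?_, ?_⟩, ?_⟩
    · obtain ⟨n, hn⟩ := s.2
      obtain ⟨t, ht, -, hts⟩ := h n hn
      exact ⟨t, by simpa using ⟨ht, hts⟩⟩
    · intro t ht t' ht'
      rw [Set.Finite.coe_toFinset] at ht ht'
      exact hX.2 t ht.1 t' ht'.1
    · ext n
      rw [Finset.mem_biUnion]
      constructor
      · intro hn
        obtain ⟨t, ht, hnt, hts⟩ := h n hn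
        exact ⟨t, by simpa using ⟨ht, hts⟩, hnt⟩
      · rintro ⟨t, ht, hnt⟩
        exact (hfin.mem_toFinset.1 ht).2 hnt

theorem union_mem_unions {X : Set FIN} (hX : IsBlockSeq X) {s t : FIN} (hs : s ∈ unions X)
    (ht : t ∈ unions X) : s.union t ∈ unions X := by
  rw [mem_unions_iff hX] at hs ht ⊢
  intro n hn
  rcases FIN.mem_union.1 hn with hn | hn
  · obtain ⟨x, hx, hnx, hxs⟩ := hs n hn
    exact ⟨x, hx, hnx, hxs.trans Finset.subset_union_left⟩
  · obtain ⟨x, hx, hnx, hxs⟩ := ht n hn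
    exact ⟨x, hx, hnx, hxs.trans Finset.subset_union_right⟩

/-- The last member of `X` used in `s ∈ [X]`. -/
theorem exists_last_block {X : Set FIN} (hX : IsBlockSeq X) {s : FIN} (hs : s ∈ unions X) :
    ∃ x ∈ X, x.1 ⊆ s.1 ∧ x.max = s.max ∧ ∀ n ∈ s.1, n ∉ x.1 → ∃ x' ∈ X, Blk x' x ∧ n ∈ x'.1 := by
  rw [mem_unions_iff hX] at hs
  obtain ⟨x, hx, hmx, hxs⟩ := hs s.max s.max_mem
  have hmax : x.max = s.max := le_antisymm (FIN.le_max (hxs x.max_mem)) (FIN.le_max hmx)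
  refine ⟨x, hx, hxs, hmax, fun n hn hnx => ?_⟩
  obtain ⟨x', hx', hnx', hxs'⟩ := hs n hn
  refine ⟨x', hx', ?_, hnx'⟩
  rcases hX.2 x' hx' x hx with h | h | h
  · exact absurd (h ▸ hnx') hnx
  · exact h
  · have h₁ := FIN.le_max (hxs' x'.min_mem)
    unfold Blk at h
    omega

/-! ### Sparse and diagonal block sequences -/

theorem IsOrderedUnion.setOf_le_min_mem {H : Ultrafilter FIN} (hH : IsOrderedUnion H) (N : ℕ) :
    {s : FIN | N ≤ s.min} ∈ H := by
  by_contra h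
  obtain ⟨X, hX, -, hXs⟩ := hH _ (Ultrafilter.compl_mem_iff_notMem.2 h)
  obtain ⟨x, hx, hN⟩ := hX.exists_le_min N
  exact hXs (subset_unions X hx) hN

/-- The number of elements of `s` that are followed closely, in the sense of `g`, by another
element of `s`. -/
def smallGaps (g : ℕ → ℕ) (s : Finset ℕ) : ℕ := by
  classical exact (s.filter fun a => ∃ b ∈ s, a < b ∧ b ≤ g a).card

/-- The only gap that can be new is the one between `max s` and `min t`. -/
theorem smallGaps_union (g : ℕ → ℕ) {s t : FIN} (h : Blk s t) :
    smallGaps g (s.union t).1 =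
      smallGaps g s.1 + smallGaps g t.1 + if t.min ≤ g s.max then 1 else 0 := by
  classical
  have hlt : ∀ a ∈ s.1, ∀ b ∈ t.1, a < b := fun a ha b hb =>
    lt_of_le_of_lt (FIN.le_max ha) (lt_of_lt_of_le h (FIN.min_le hb))
  have hdisj : Disjoint s.1 t.1 :=
    Finset.disjoint_left.2 fun a ha hb => lt_irrefl a (hlt a ha a hb)
  have ht : t.1.filter (fun a => ∃ b ∈ s.1 ∪ t.1, a < b ∧ b ≤ g a) =
      t.1.filter fun a => ∃ b ∈ t.1, a < b ∧ b ≤ g a := by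
    refine Finset.filter_congr fun a ha => ⟨?_, ?_⟩
    · rintro ⟨b, hb, hab, hbg⟩
      rcases Finset.mem_union.1 hb with hb | hb
      · exact absurd (hlt b hb a ha) (by omega)
      · exact ⟨b, hb, hab, hbg⟩
    · rintro ⟨b, hb, hab⟩
      exact ⟨b, Finset.mem_union_right _ hb, hab⟩
  have hs : (s.1.filter (fun a => ∃ b ∈ s.1 ∪ t.1, a < b ∧ b ≤ g a)).card =
      (s.1.filter fun a => ∃ b ∈ s.1, a < b ∧ b ≤ g a).card +
        if t.min ≤ g s.max then 1 else 0 := by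
    have key : ∀ a ∈ s.1, (∃ b ∈ s.1 ∪ t.1, a < b ∧ b ≤ g a) ↔
        (∃ b ∈ s.1, a < b ∧ b ≤ g a) ∨ (a = s.max ∧ t.min ≤ g s.max) := by
      intro a ha
      constructor
      · rintro ⟨b, hb, hab, hbg⟩
        rcases Finset.mem_union.1 hb with hb | hb
        · exact .inl ⟨b, hb, hab, hbg⟩
        -- An element of `s` below `max s` that is closely followed by an element of `t` is closely
        -- followed by `max s` as well, so it was counted already.
        · by_cases hm : a = s.max
          · exact .inr ⟨hm, (FIN.min_le hb).trans (hm ▸ hbg)⟩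
          · exact .inl ⟨s.max, s.max_mem, lt_of_le_of_ne (FIN.le_max ha) hm,
              (hlt _ s.max_mem b hb).le.trans hbg⟩
      · rintro (⟨b, hb, hab⟩ | ⟨rfl, hg⟩)
        · exact ⟨b, Finset.mem_union_left _ hb, hab⟩
        · exact ⟨t.min, Finset.mem_union_right _ t.min_mem, h, hg⟩
    rw [Finset.filter_congr key]
    split_ifs with hg
    · have : s.1.filter (fun a => (∃ b ∈ s.1, a < b ∧ b ≤ g a) ∨ (a = s.max ∧ t.min ≤ g s.max)) =
          insert s.max (s.1.filter fun a => ∃ b ∈ s.1, a < b ∧ b ≤ g a) := by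
        ext a
        simp only [Finset.mem_filter, Finset.mem_insert, hg, and_true]
        constructor
        · rintro ⟨ha, h | h⟩
          · exact .inr ⟨ha, h⟩
          · exact .inl h
        · rintro (rfl | ⟨ha, h⟩)
          · exact ⟨s.max_mem, .inr rfl⟩
          · exact ⟨ha, .inl h⟩
      rw [this, Finset.card_insert_of_notMem]
      simp only [Finset.mem_filter, not_and, not_exists]
      intro _ b hb hlt' _
      exact absurd (FIN.le_max hb) (by omega)
    · simp [hg]
  unfold smallGaps
  rw [show (s.union t).1 = s.1 ∪ t.1 from rfl, Finset.filter_union,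
    Finset.card_union_of_disjoint (Finset.disjoint_filter_filter hdisj), ht, hs]
  omega

/-- Make the parity `e` of the number of small gaps constant on `[X]`. For `x` before `x'` the
parities satisfy `e + e + δ = e`, where `δ` tells whether the gap is small, so `δ` is the same for
all pairs. A sufficiently distant second block makes it `0`. -/
theorem IsOrderedUnion.exists_sparse {H : Ultrafilter FIN} (hH : IsOrderedUnion H) (g : ℕ → ℕ)
    {B : Set FIN} (hB : B ∈ H) : ∃ X, IsInfBlockSeq X ∧ unions X ∈ H ∧ unions X ⊆ B ∧
      ∀ x ∈ X, ∀ x' ∈ X, Blk x x' → g x.max < x'.min := by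
  obtain ⟨e, he⟩ : ∃ e : ℕ, {s : FIN | smallGaps g s.1 % 2 = e % 2} ∈ H := by
    by_cases h : {s : FIN | smallGaps g s.1 % 2 = 0 % 2} ∈ H
    · exact ⟨0, h⟩
    · refine ⟨1, Filter.mem_of_superset (Ultrafilter.compl_mem_iff_notMem.2 h) fun s hs => ?_⟩
      simp only [Set.mem_compl_iff, Set.mem_ofPred_eq] at hs ⊢
      omega
  obtain ⟨X, hX, hXH, hXs⟩ := hH _ (Filter.inter_mem hB he)
  refine ⟨X, hX, hXH, fun s hs => (hXs hs).1, ?_⟩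
  have key : ∀ x ∈ X, ∀ x' ∈ X, Blk x x' → (e + if x'.min ≤ g x.max then 1 else 0) % 2 = 0 := by
    intro x hx x' hx' hb
    have h₁ : smallGaps g x.1 % 2 = e % 2 := (hXs (subset_unions X hx)).2
    have h₂ : smallGaps g x'.1 % 2 = e % 2 := (hXs (subset_unions X hx')).2
    have h₃ : smallGaps g (x.union x').1 % 2 = e % 2 :=
      (hXs (union_mem_unions hX.1 (subset_unions X hx) (subset_unions X hx'))).2
    rw [smallGaps_union g hb] at h₃
    omega
  intro x hx x' hx' hb
  by_contra! hle
  obtain ⟨x'', hx'', hN⟩ := hX.exists_le_min (max (x.max + 1) (g x.max + 1))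
  have h₁ := key x hx x' hx' hb
  have h₂ := key x hx x'' hx'' (show x.max < x''.min by omega)
  rw [if_pos hle] at h₁
  rw [if_neg (by omega)] at h₂
  omega

/-- Stability gives one `Y` whose members beyond a bound `h n` lie in `[Z n] ⊆ A n`. A block
sequence inside `[Y]` whose gaps outgrow `h` then enters each required set in time. -/
theorem IsStableOrderedUnion.exists_diagonal {H : Ultrafilter FIN} (hH : IsStableOrderedUnion H)
    (A : ℕ → Set FIN) (hA : ∀ n, A n ∈ H) : ∃ X, IsInfBlockSeq X ∧ unions X ∈ H ∧
      unions X ⊆ A 0 ∧ ∀ x ∈ X, ∀ x' ∈ X, Blk x x' → x' ∈ A (x.max + 1) := by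
  choose Z hZ hZH hZA using fun n => hH.1 (A n) (hA n)
  obtain ⟨Y, hY, hYH, hYZ⟩ := hH.2 Z fun n => ⟨hZ n, hZH n⟩
  have hbound : ∀ n, ∃ N, ∀ t ∈ Y, N < t.min → t ∈ unions (Z n) := by
    intro n
    obtain ⟨N, hN⟩ := ((hYZ n).image FIN.min).bddAbove
    refine ⟨N, fun t ht hlt => ?_⟩
    by_contra hn
    exact absurd (hN ⟨t, ⟨ht, hn⟩, rfl⟩) (by omega)
  choose h hh using hbound
  -- The shift by one matches the index `x.max + 1`, the first number above the block `x`.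
  obtain ⟨X, hX, hXH, hXB, hXs⟩ :=
    hH.1.exists_sparse (fun m => h (m + 1)) (Filter.inter_mem hYH (hA 0))
  refine ⟨X, hX, hXH, fun s hs => (hXB hs).2, fun x hx x' hx' hb => hZA _ ?_⟩
  have hlt := hXs x hx x' hx' hb
  rw [mem_unions_iff (hZ _).1]
  intro n hn
  obtain ⟨y, hy, hny, hyx⟩ := (mem_unions_iff hY.1).1 (hXB (subset_unions X hx')).1 n hn
  have hy' := hh _ y hy (lt_of_lt_of_le hlt (FIN.min_le (hyx y.min_mem)))
  obtain ⟨z, hz, hnz, hzy⟩ := (mem_unions_iff (hZ _).1).1 hy' n hny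
  exact ⟨z, hz, hnz, hzy.trans hyx⟩

/-! ### Conditions -/

/-- The value of a node at level `l` on the set `x`. -/
def Node.eval {m : ℕ} (f : Node m) (l : ℕ) (x : Finset ℕ) : Bool :=
  if h : l < m ∧ x ⊆ Finset.range l then f l h.1 ⟨x, h.2⟩ else false

theorem Node.eval_restrict {m m' : ℕ} (f : Node m) (h : m' ≤ m) {l : ℕ} (hl : l < m')
    (x : Finset ℕ) : (f.restrict h).eval l x = f.eval l x := by
  unfold Node.eval Node.restrict
  simp [hl, lt_of_lt_of_le hl h]

theorem Node.eval_of_subset {m : ℕ} (f : Node m) {l : ℕ} (hl : l < m) {x : Finset ℕ}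
    (hx : x ⊆ Finset.range l) : f.eval l x = f l hl ⟨x, hx⟩ := dif_pos ⟨hl, hx⟩

/-- Total functions on finite sets replace dependent ones, and the level `l` is tied to `max s` only
by an equation. Nodes on the levels of two blocks with the same maximum can thus be compared without
casts. -/
theorem mem_bigSet_iff {T : Set TT} {k : ℕ} {s : FIN} :
    s ∈ bigSet T k ↔ k ≤ s.max ∧ ∀ l, l = s.max → ∀ f : Node l, (⟨l, f⟩ : TT) ∈ T →
      ∀ σ : Finset ℕ → Bool, ∃ g : Node (l + 1), (⟨l + 1, g⟩ : TT) ∈ T ∧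
        g.restrict (Nat.le_succ l) = f ∧
        ∀ x ⊆ Finset.range k, g.eval l (x ∪ s.minus) = σ x := by
  constructor
  · rintro ⟨hk, h⟩
    refine ⟨hk, ?_⟩
    rintro l rfl f hf σ
    obtain ⟨τ, ⟨g, hg, hgf, rfl⟩, hσ⟩ := h f hf fun x => σ x.1
    refine ⟨g, hg, hgf, fun x hx => ?_⟩
    rw [g.eval_of_subset (Nat.lt_succ_self _) (union_minus_subset hk hx)]
    exact (hσ x hx).symm
  · rintro ⟨hk, h⟩
    refine ⟨hk, fun f hf σ => ?_⟩
    obtain ⟨g, hg, hgf, hσ⟩ := h _ rfl f hf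
      fun x => if hx : x ⊆ Finset.range k then σ ⟨x, hx⟩ else false
    refine ⟨_, ⟨g, hg, hgf, rfl⟩, fun x hx => ?_⟩
    have := hσ x hx
    rw [g.eval_of_subset (Nat.lt_succ_self _) (union_minus_subset hk hx), dif_pos hx] at this
    exact this.symm

theorem IsCondition.exists_succ {H : Ultrafilter FIN} {T : Set TT} (hT : IsCondition H T) {l : ℕ}
    {f : Node l} (hf : (⟨l, f⟩ : TT) ∈ T) : ∃ g : Node (l + 1), (⟨l + 1, g⟩ : TT) ∈ T ∧
      g.restrict (Nat.le_succ l) = f := by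
  obtain ⟨m, g, h, hg, hgf, hm⟩ := hT.extend l f hf (l + 1) (Nat.le_succ l)
  exact ⟨g.restrict hm, hT.subtree m g hg _ hm, hgf⟩

theorem exists_extension_of_exists_succ {T : Set TT}
    (hT : ∀ (l : ℕ) (f : Node l), (⟨l, f⟩ : TT) ∈ T → ∃ g : Node (l + 1),
      (⟨l + 1, g⟩ : TT) ∈ T ∧ g.restrict (Nat.le_succ l) = f)
    {l : ℕ} {f : Node l} (hf : (⟨l, f⟩ : TT) ∈ T) {n : ℕ} (hn : l ≤ n) :
    ∃ g : Node n, (⟨n, g⟩ : TT) ∈ T ∧ g.restrict hn = f := by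
  induction n, hn using Nat.le_induction with
  | base => exact ⟨f, hf, rfl⟩
  | succ n hn ih =>
    obtain ⟨g, hg, hgf⟩ := ih
    obtain ⟨g', hg', hgf'⟩ := hT n g hg
    refine ⟨g', hg', ?_⟩
    rw [← hgf, ← hgf']
    rfl

theorem IsCondition.exists_node {H : Ultrafilter FIN} {T : Set TT} (hT : IsCondition H T) (n : ℕ) :
    ∃ g : Node n, (⟨n, g⟩ : TT) ∈ T := by
  obtain ⟨g, hg, -⟩ := exists_extension_of_exists_succ (fun _ _ => hT.exists_succ)
    (hT.root fun k hk => absurd hk (Nat.not_lt_zero k)) (Nat.zero_le n)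
  exact ⟨g, hg⟩

theorem IsCondition.branches_nonempty {H : Ultrafilter FIN} {T : Set TT} (hT : IsCondition H T) :
    (branches T).Nonempty := by
  choose! step hstep hres using fun (t : TT) (ht : t ∈ T) => hT.exists_succ (f := t.2) ht
  let f₀ : Node 0 := fun k hk => absurd hk (Nat.not_lt_zero k)
  let f : ∀ n : ℕ, Node n := fun n => Nat.rec f₀ (fun n g => step ⟨n, g⟩) n
  have hf : ∀ n, (⟨n, f n⟩ : TT) ∈ T := by
    intro n
    induction n with
    | zero => exact hT.root _
    | succ n ih => exact hstep _ ih
  have hval : ∀ n k (hk : k < n), f n k hk = f (k + 1) k (Nat.lt_succ_self k) := by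
    intro n k hk
    induction n, (show k + 1 ≤ n from hk) using Nat.le_induction with
    | base => rfl
    | succ n hn ih =>
      rw [← ih hn]
      exact congrFun (congrFun (hres _ (hf n)) k) hn
  refine ⟨fun k => f (k + 1) k (Nat.lt_succ_self k), fun l => ?_⟩
  convert hf l using 2
  funext k hk
  exact (hval l k hk).symm

/-- The nodes of `T` that are compatible with the node `f`. -/
def cone (T : Set TT) {n : ℕ} (f : Node n) : Set TT :=
  {t | t ∈ T ∧ ∀ (k : ℕ) (h : k < t.1) (h' : k < n), t.2 k h = f k h'}

/-- Beyond the length of `f`, nodes of the cone have the same successors as in `T`. Bigness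
therefore persists for all `s` with `n ≤ min s`, and these form a set in `H`. -/
theorem isCondition_cone {H : Ultrafilter FIN} (hH : IsOrderedUnion H) {T : Set TT}
    (hT : IsCondition H T) {n : ℕ} {f : Node n} (hf : (⟨n, f⟩ : TT) ∈ T) :
    IsCondition H (cone T f) where
  subtree l g hg l' h := ⟨hT.subtree l g hg.1 l' h, fun k hk hk' =>
    hg.2 k (lt_of_lt_of_le hk h) hk'⟩
  root g := ⟨hT.root g, fun k hk => absurd hk (Nat.not_lt_zero k)⟩
  extend l g hg m hm := by
    rcases le_total n l with hn | hn
    · obtain ⟨m', g', h, hg', rfl, hm'⟩ := hT.extend l g hg.1 m hm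
      exact ⟨m', g', h, ⟨hg', fun k hk hk' => hg.2 k (lt_of_lt_of_le hk' hn) hk'⟩, rfl, hm'⟩
    · obtain ⟨m', g', h, hg', rfl, hm'⟩ := hT.extend n f hf (max n m) (le_max_left _ _)
      refine ⟨m', g', hn.trans h, ⟨hg', fun k hk hk' => rfl⟩, ?_, (le_max_right _ _).trans hm'⟩
      funext k hk
      exact (hg.2 k hk (lt_of_lt_of_le hk hn)).symm
  big k := by
    refine Filter.mem_of_superset (Filter.inter_mem (hT.big k) (hH.setOf_le_min_mem n)) ?_
    rintro s ⟨hs, hsn⟩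
    rw [mem_bigSet_iff] at hs ⊢
    refine ⟨hs.1, ?_⟩
    rintro l rfl g hg σ
    obtain ⟨g', hg', hres, hσ⟩ := hs.2 _ rfl g hg.1 σ
    refine ⟨g', ⟨hg', fun j hj hj' => ?_⟩, hres, hσ⟩
    have hlt : j < s.max := lt_of_lt_of_le hj' (le_trans hsn s.min_le_max)
    rw [← hg.2 j hlt hj', ← hres]
    rfl

/-- A node of length `max s + 1` already contains the value that defines the colour of `s`, so its
cone decides it. -/
theorem exists_decides {H : Ultrafilter FIN} (hH : IsOrderedUnion H) (p : Cond H) (s : FIN) :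
    ∃ p' ≤ p, ∃ t, Decides p' s t := by
  obtain ⟨f, hf⟩ := p.2.exists_node (s.max + 1)
  refine ⟨⟨cone p.1 f, isCondition_cone hH p.2 hf⟩, fun t ht => ht.1,
    f s.max (Nat.lt_succ_self _) ⟨s.minus, s.minus_subset⟩, fun F hF => ?_⟩
  have := (hF (s.max + 1)).2 s.max (Nat.lt_succ_self _) (Nat.lt_succ_self _)
  exact congrFun this _

/-- The nodes of `T` at which, on all levels `max x` with `x ∈ X`, the value on `v ∪ x⁻` is
changed by adding any nonempty subset of the interval `[a x, b x)` to `v ⊆ a x`. -/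
def flipTree (T : Set TT) (X : Set FIN) (a b : FIN → ℕ) : Set TT :=
  {t | t ∈ T ∧ ∀ x ∈ X, x.max < t.1 → ∀ v ⊆ Finset.range (a x), ∀ y ⊆ Finset.Ico (a x) (b x),
    y.Nonempty → t.2.eval x.max (v ∪ y ∪ x.minus) = !t.2.eval x.max (v ∪ x.minus)}

/-! ### Thinning a condition so that insertions flip the colour -/

section FlipTree

variable {H : Ultrafilter FIN} {T : Set TT} {X : Set FIN} {a b : FIN → ℕ}

theorem mem_bigSet_flipTree (hX : IsBlockSeq X) {x : FIN} (hx : x ∈ X) (hab : a x ≤ b x)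
    (hb : x ∈ bigSet T (b x)) : x ∈ bigSet (flipTree T X a b) (a x) := by
  rw [mem_bigSet_iff] at hb ⊢
  refine ⟨hab.trans hb.1, ?_⟩
  rintro l rfl f hf σ
  -- The prescribed pattern on `w ⊆ b x` follows `σ` on the part of `w` below `a x` and is negated
  -- when `w` meets `[a x, b x)`.
  obtain ⟨g, hg, hgf, hσ⟩ := hb.2 _ rfl f hf.1 fun w =>
    if (w ∩ Finset.Ico (a x) (b x)).Nonempty then !σ (w ∩ Finset.range (a x))
    else σ (w ∩ Finset.range (a x))
  have hIco : Finset.Ico (a x) (b x) ⊆ Finset.range (b x) := fun n hn =>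
    Finset.mem_range.2 (Finset.mem_Ico.1 hn).2
  have hdisj : Finset.range (a x) ∩ Finset.Ico (a x) (b x) = ∅ := by
    ext n
    simp only [Finset.mem_inter, Finset.mem_range, Finset.mem_Ico, Finset.notMem_empty, iff_false]
    omega
  have hval : ∀ v ⊆ Finset.range (a x), g.eval x.max (v ∪ x.minus) = σ v := by
    intro v hv
    rw [hσ v (hv.trans (Finset.range_subset_range.2 hab)), if_neg,
      Finset.inter_eq_left.2 hv]
    rw [Finset.not_nonempty_iff_eq_empty, ← Finset.subset_empty, ← hdisj]
    exact Finset.inter_subset_inter_right hv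
  refine ⟨g, ⟨hg, fun x' hx' hlt v hv y hy hne => ?_⟩, hgf, hval⟩
  rcases Nat.lt_succ_iff_lt_or_eq.1 hlt with hlt | heq
  · have := hf.2 x' hx' hlt v hv y hy hne
    rwa [← hgf, Node.eval_restrict _ _ hlt, Node.eval_restrict _ _ hlt] at this
  -- Distinct blocks have distinct maxima, so only `x` imposes a constraint on the new level.
  · obtain rfl := hX.max_injOn hx' hx heq
    rw [hval v hv, hσ _ (Finset.union_subset (hv.trans (Finset.range_subset_range.2 hab))
      (hy.trans hIco)), if_pos]
    · congr 2
      rw [Finset.union_inter_distrib_right, Finset.inter_eq_left.2 hv, Finset.union_eq_left,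
        Finset.inter_comm]
      refine (Finset.inter_subset_inter_left hy).trans ?_
      rw [hdisj]
      exact Finset.empty_subset _
    · obtain ⟨n, hn⟩ := hne
      exact ⟨n, Finset.mem_inter.2 ⟨Finset.mem_union_right _ hn, hy hn⟩⟩

theorem minus_eq_of_last_block {s x : FIN} (hxs : x.1 ⊆ s.1) (hmax : x.max = s.max) :
    s.minus = (s.1 \ x.1) ∪ x.minus := by
  ext n
  simp only [FIN.minus, Finset.mem_erase, Finset.mem_union, Finset.mem_sdiff, hmax]
  constructor
  · rintro ⟨hn, hs⟩
    by_cases hx : n ∈ x.1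
    · exact .inr ⟨hn, hx⟩
    · exact .inl ⟨hs, hx⟩
  · rintro (⟨hs, hx⟩ | ⟨hn, hx⟩)
    · exact ⟨fun h => hx (h ▸ hmax ▸ x.max_mem), hs⟩
    · exact ⟨hn, hxs hx⟩

/-- Let `s ∈ [X]` have last block `x`. The earlier blocks end below `a x`, so `s⁻ = v ∪ x⁻` with `v
⊆ a x`, and `(a x, x)`-bigness controls the values on all `u ∪ s⁻` with `u ⊆ k`, once `k ≤ a x` and
`v` lies above `k`. -/
theorem isCondition_flipTree (hH : IsOrderedUnion H) (hT : IsCondition H T) (hX : IsInfBlockSeq X)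
    (hXH : unions X ∈ H) (ha : ∀ x ∈ X, ∀ x' ∈ X, Blk x x' → x.max < a x')
    (hab : ∀ x ∈ X, a x ≤ b x) (hb : ∀ x ∈ X, x ∈ bigSet T (b x)) :
    IsCondition H (flipTree T X a b) where
  subtree l f hf l' h := ⟨hT.subtree l f hf.1 l' h, fun x hx hlt v hv y hy hne => by
    have := hf.2 x hx (lt_of_lt_of_le hlt h) v hv y hy hne
    rwa [← Node.eval_restrict f h hlt, ← Node.eval_restrict f h hlt] at this⟩
  root f := ⟨hT.root f, fun x _ h => absurd h (Nat.not_lt_zero _)⟩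
  extend l f hf n hn := by
    suffices h : ∀ (l : ℕ) (f : Node l), (⟨l, f⟩ : TT) ∈ flipTree T X a b →
        ∃ g : Node (l + 1), (⟨l + 1, g⟩ : TT) ∈ flipTree T X a b ∧
          g.restrict (Nat.le_succ l) = f by
      obtain ⟨g, hg, hgf⟩ := exists_extension_of_exists_succ h hf hn
      exact ⟨n, g, hn, hg, hgf, le_rfl⟩
    clear hn hf f l
    intro l f hf
    -- Constraints are added only on levels `max x`, where bigness provides a successor. On other
    -- levels any successor in `T` will do.
    by_cases h : ∃ x ∈ X, l = x.max
    · obtain ⟨x, hx, hl⟩ := h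
      obtain ⟨g, hg, hgf, -⟩ := (mem_bigSet_iff.1 (mem_bigSet_flipTree hX.1 hx (hab x hx)
        (hb x hx))).2 l hl f hf fun _ => false
      exact ⟨g, hg, hgf⟩
    · push Not at h
      obtain ⟨g, hg, hgf⟩ := hT.exists_succ hf.1
      refine ⟨g, ⟨hg, fun x hx hlt v hv y hy hne => ?_⟩, hgf⟩
      have hlt : x.max < l :=
        lt_of_le_of_ne (Nat.lt_succ_iff.1 hlt) fun heq => h x hx heq.symm
      have := hf.2 x hx hlt v hv y hy hne
      rwa [← hgf, Node.eval_restrict _ _ hlt, Node.eval_restrict _ _ hlt] at this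
  big k := by
    -- Only `s` lying beyond a block `z` above `k` are used: their last block `x` comes after `z`,
    -- whence `k ≤ z.max < a x`.
    obtain ⟨z, hz, hkz⟩ := hX.exists_le_min k
    refine Filter.mem_of_superset
      (Filter.inter_mem hXH (hH.setOf_le_min_mem (z.max + 1))) ?_
    rintro s ⟨hs, hsz⟩
    replace hsz : z.max + 1 ≤ s.min := hsz
    have hkz' : k ≤ z.max := hkz.trans z.min_le_max
    obtain ⟨x, hx, hxs, hmax, hv⟩ := exists_last_block hX.1 hs
    have hzx : z.max < a x := ha z hz x hx
      (lt_of_lt_of_le (Nat.lt_of_succ_le hsz) (FIN.min_le (hxs x.min_mem)))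
    have hva : s.1 \ x.1 ⊆ Finset.range (a x) := by
      intro n hn
      rw [Finset.mem_sdiff] at hn
      obtain ⟨x', hx', hb', hnx'⟩ := hv n hn.1 hn.2
      exact Finset.mem_range.2 (lt_of_le_of_lt (FIN.le_max hnx') (ha x' hx' x hx hb'))
    have hbig := mem_bigSet_iff.1 (mem_bigSet_flipTree hX.1 hx (hab x hx) (hb x hx))
    rw [mem_bigSet_iff]
    refine ⟨by have := s.min_le_max; omega, fun l hl f hf σ => ?_⟩
    -- For `w = u ∪ v` the set `v ⊆ s` lies above `k`, so `w ∩ k` recovers `u`.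
    obtain ⟨g, hg, hgf, hσ⟩ := hbig.2 l (hl.trans hmax.symm) f hf fun w =>
      σ (w ∩ Finset.range k)
    refine ⟨g, hg, hgf, fun u hu => ?_⟩
    rw [minus_eq_of_last_block hxs hmax, ← Finset.union_assoc, hσ]
    · congr 1
      rw [Finset.union_inter_distrib_right, Finset.inter_eq_left.2 hu, Finset.union_eq_left]
      intro n hn
      rw [Finset.mem_inter, Finset.mem_sdiff, Finset.mem_range] at hn
      exact absurd (FIN.min_le hn.1.1) (by omega)
    · exact Finset.union_subset (hu.trans (Finset.range_subset_range.2 (by omega))) hva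

end FlipTree

/-- The colour given to `s` by a branch. -/
def branchColour (F : ∀ k : ℕ, Col k) (s : FIN) : Bool := F s.max ⟨s.minus, s.minus_subset⟩

theorem branchColour_eq_eval (F : ∀ k : ℕ, Col k) {s : FIN} {l : ℕ} (h : s.max < l) :
    branchColour F s = Node.eval (m := l) (fun k _ => F k) s.max s.minus :=
  (Node.eval_of_subset (m := l) (fun k _ => F k) h s.minus_subset).symm

/-- Apply diagonalization to the sets of `s` that are big for `max n (ψ n)`, and thin at `[a x, b
x)` with `b x = max (a x) (ψ (a x))`. For `s ∈ [X]` with last block `x`, the witness is `n = a x`,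
and inserting `y` from `[n, ψ n)` flips the value on the level `max x`. -/
theorem exists_flipping {H : Ultrafilter FIN} (hH : IsStableOrderedUnion H) (p : Cond H)
    (ψ : ℕ → ℕ) : ∃ p' ≤ p, ∃ A ∈ H, ∀ s ∈ A, ∃ n, ∀ y : FIN, n ≤ y.min → y.max < ψ n →
      ∀ F ∈ branches p'.1, branchColour F (s.union y) ≠ branchColour F s := by
  classical
  obtain ⟨X, hX, hXH, hX0, hXd⟩ := hH.exists_diagonal
    (fun n => bigSet p.1 (max n (ψ n))) (fun n => p.2.big _)
  have hexa : ∀ x ∈ X, ∃ n, x ∈ bigSet p.1 (max n (ψ n)) ∧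
      ∀ x' ∈ X, Blk x' x → x'.max < n := by
    intro x hx
    -- The number `a x` is one more than the greatest maximum of a preceding block; these maxima are
    -- bounded by `min x`. For the first block it is `0`, where the diagonal sequence gives bigness
    -- through `A 0`.
    by_cases h : ∃ m, ∃ x' ∈ X, Blk x' x ∧ x'.max = m
    · have hbdd : ∀ m, (∃ x' ∈ X, Blk x' x ∧ x'.max = m) → m ≤ x.min := by
        rintro _ ⟨x', -, hb, rfl⟩
        exact le_of_lt hb
      obtain ⟨m, hm⟩ := h
      obtain ⟨x', hx', hb, heq⟩ := Nat.findGreatest_spec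
        (P := fun m => ∃ x' ∈ X, Blk x' x ∧ x'.max = m) (hbdd m hm) hm
      refine ⟨x'.max + 1, hXd x' hx' x hx hb, fun z hz hzb => ?_⟩
      have := Nat.le_findGreatest
        (P := fun m => ∃ x' ∈ X, Blk x' x ∧ x'.max = m) (hbdd _ ⟨z, hz, hzb, rfl⟩) ⟨z, hz, hzb, rfl⟩
      omega
    · exact ⟨0, hX0 (subset_unions X hx), fun x' hx' hb => absurd ⟨_, x', hx', hb, rfl⟩ h⟩
  choose! a ha₁ ha₂ using hexa
  let b : FIN → ℕ := fun x => max (a x) (ψ (a x))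
  refine ⟨⟨flipTree p.1 X a b, isCondition_flipTree hH.1 p.2 hX hXH
    (fun x hx x' hx' hb => ha₂ x' hx' x hx hb) (fun x _ => le_max_left _ _) ha₁⟩,
    fun t ht => ht.1, unions X, hXH, fun s hs => ?_⟩
  obtain ⟨x, hx, hxs, hmax, hv⟩ := exists_last_block hX.1 hs
  refine ⟨a x, fun y hy hyψ F hF => ?_⟩
  -- Bigness includes `ψ (a x) ≤ max x`. Hence `y` does not change the maximum, and both colours are
  -- read off on the same level.
  have hyx : y.max < x.max := by
    have h₁ := (mem_bigSet_iff.1 (ha₁ x hx)).1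
    omega
  have hys : (s.union y).max = s.max := by
    refine le_antisymm (Finset.max'_le _ _ _ fun n hn => ?_)
      (FIN.le_max (FIN.mem_union.2 (.inl s.max_mem)))
    rcases FIN.mem_union.1 hn with hn | hn
    · exact FIN.le_max hn
    · have := FIN.le_max hn
      omega
  have hva : s.1 \ x.1 ⊆ Finset.range (a x) := by
    intro n hn
    rw [Finset.mem_sdiff] at hn
    obtain ⟨x', hx', hb', hnx'⟩ := hv n hn.1 hn.2
    exact Finset.mem_range.2 (lt_of_le_of_lt (FIN.le_max hnx') (ha₂ x hx x' hx' hb'))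
  have hminus : (s.union y).minus = (s.1 \ x.1) ∪ y.1 ∪ x.minus := by
    have h₁ : (s.union y).minus = s.minus ∪ y.1 := by
      ext n
      simp only [FIN.minus, hys, Finset.mem_erase, Finset.mem_union, FIN.mem_union]
      constructor
      · rintro ⟨hn, h | h⟩
        · exact .inl ⟨hn, h⟩
        · exact .inr h
      · rintro (⟨hn, h⟩ | h)
        · exact ⟨hn, .inl h⟩
        · have := FIN.le_max h
          exact ⟨by omega, .inr h⟩
    rw [h₁, minus_eq_of_last_block hxs hmax, Finset.union_right_comm]
  have hflip := (hF (x.max + 1)).2 x hx (Nat.lt_succ_self _) _ hva y.1 (fun n hn => by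
    have h₁ := FIN.min_le hn
    have h₂ := FIN.le_max hn
    exact Finset.mem_Ico.2 ⟨by omega, lt_of_lt_of_le (by omega) (le_max_right _ _)⟩) y.2
  rw [branchColour_eq_eval F (s := s.union y) (l := x.max + 1) (by omega),
    branchColour_eq_eval F (s := s) (l := x.max + 1) (by omega), hys, hminus,
    minus_eq_of_last_block hxs hmax, ← hmax, hflip]
  exact Bool.not_ne_self _

section Witness

variable {Q : Type u} [Preorder Q] {p q : Q}

/-! ### Infinite block sequences in the extension -/

theorem densely_eq_finName_of_mem {Y z : Name Q} (hY : p ⊩ .subFIN Y) (hz : p ⊩ .mem z Y) :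
    Densely p fun r => ∃ s, (r ⊩ .eq z (finName Q s)) ∧ (r ⊩ .mem (finName Q s) Y) :=
  (forces_isFIN.1 (forces_allIn.1 hY z p le_rfl hz)).imp fun _ hr ⟨s, hs⟩ =>
    ⟨s, hs, (hz.mono hr).mem_congr_left hs⟩

theorem densely_exists_finName_mem {Y : Name Q} (hY : p ⊩ .isInfBlockSeq Y) (n : ℕ) :
    Densely p fun r => ∃ s : FIN, n ≤ s.min ∧ (r ⊩ .mem (finName Q s) Y) := by
  induction n with
  | zero =>
    refine (forces_ex.1 hY.1.2.1).bind fun r hr ⟨z, hz⟩ => ?_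
    exact (densely_eq_finName_of_mem (Forces.mono hY.1.1 hr) hz).imp
      fun _ _ ⟨s, _, hs⟩ => ⟨s, Nat.zero_le _, hs⟩
  | succ n ih =>
    refine ih.bind fun r hr ⟨s, hns, hs⟩ => ?_
    refine (forces_exIn.1 (forces_allIn.1 hY.2 _ r hr hs)).bind fun r' hr' ⟨z, hz, hb⟩ => ?_
    refine (densely_eq_finName_of_mem (Forces.mono hY.1.1 (hr'.trans hr)) hz).imp
      fun r'' hr'' ⟨t, he, ht⟩ => ⟨t, ?_, ht⟩
    have := forces_blk_finName (respects_blk_right _ _ _ _ he (hb.mono hr''))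
    have := s.min_le_max
    unfold Blk at *
    omega

/-- In an `ω^ω`-bounding extension, the members of an infinite block sequence are found below
bounds that are given by a function of the ground model. -/
theorem IsBounding.exists_bound (hQ : IsBounding Q) {Y : Name Q} (hY : p ⊩ .isInfBlockSeq Y) :
    ∃ q ≤ p, ∃ ψ : ℕ → ℕ, ∀ n, Densely q fun r =>
      ∃ s : FIN, n ≤ s.min ∧ s.max < ψ n ∧ (r ⊩ .mem (finName Q s) Y) := by
  let D : ℕ → ℕ → Set Q := fun n m =>
    {r | ∃ s : FIN, n ≤ s.min ∧ s.max < m ∧ (r ⊩ .mem (finName Q s) Y)}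
  have hD : ∀ {n m r r'}, r ∈ D n m → r' ≤ r → r' ∈ D n m :=
    fun ⟨s, h₁, h₂, h₃⟩ hr => ⟨s, h₁, h₂, h₃.mono hr⟩
  -- This names the function that sends `n` to the least `m` such that some member of `Y` lies in
  -- `[n, m)`. Minimality, required of all extensions, makes the value unique.
  let cond : ℕ → ℕ → Set Q := fun n m => {r | r ∈ D n m ∧ ∀ m' < m, ∀ r' ≤ r, r' ∉ D n m'}
  have hinj : ∀ i i' : ℕ, (PSet.ofNat.{u} i).Equiv (PSet.ofNat.{u} i') → i = i' :=
    fun _ _ => ofNat_injective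
  have hfun : p ⊩ .isFun .isNat .isNat (relName PSet.ofNat PSet.ofNat cond) := by
    refine forces_isFun_relName hinj (fun q _ x hx => forces_isNat.1 hx)
      (fun n => forces_isNat_natName n p) (fun n => forces_isNat_natName n p) ?_ ?_
    · intro n q hq
      classical
      have hex : ∃ m, ∃ r ≤ q, r ∈ D n m := by
        obtain ⟨r, hr, s, hns, hs⟩ := densely_exists_finName_mem hY n q hq
        exact ⟨s.max + 1, r, hr, s, hns, Nat.lt_succ_self _, hs⟩
      obtain ⟨r, hr, hrD⟩ := Nat.find_spec hex
      exact ⟨r, hr, Nat.find hex, r, ⟨hrD, fun m' hm' r' hr' h =>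
        Nat.find_min hex hm' ⟨r', hr'.trans hr, h⟩⟩, le_rfl⟩
    · rintro n m m' r - ⟨q, hq, hrq⟩ ⟨q', hq', hrq'⟩
      rcases lt_trichotomy m m' with h | h | h
      · exact absurd (hD hq.1 hrq) (hq'.2 m h r hrq')
      · exact h
      · exact absurd (hD hq'.1 hrq') (hq.2 m' h r hrq)
  obtain ⟨q, hq, ψ, hψ⟩ := hQ _ p hfun
  refine ⟨q, hq, ψ, fun n => ?_⟩
  refine (forces_ex.1 (hψ n)).bind fun r₁ hr₁ ⟨x, hx, hle⟩ => ?_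
  refine (densely_of_forces_pairIn_relName hinj hx).bind fun r₂ hr₂ ⟨m, ⟨q', hq', hrq'⟩, he⟩ => ?_
  refine (forces_or.1 (hle.mono hr₂)).imp fun r hr h => ?_
  obtain ⟨s, hns, hsm, hs⟩ := hD hq'.1 (hr.trans hrq')
  refine ⟨s, hns, lt_of_lt_of_le hsm ?_, hs⟩
  rcases h with h | h
  · exact (ofNat_mem_ofNat.1 (mem_of_forces_check_mem (h.mem_congr_left (he.mono hr)))).le
  · exact (ofNat_injective (equiv_of_forces_check_eq ((he.mono hr).symm.trans h))).le

theorem forces_inUnions_finName_union {Y : Name Q} {s y : FIN}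
    (hs : p ⊩ .inUnions (finName Q s) Y) (hy : p ⊩ .mem (finName Q y) Y) :
    p ⊩ .inUnions (finName Q (s.union y)) Y := by
  have hmem : ∀ {t : FIN}, t.1 ⊆ (s.union y).1 → ∀ q : Q,
      q ⊩ .subset (finName Q t) (finName Q (s.union y)) := fun ht q =>
    forces_subset.2 fun z r _ hz => forces_mem_finName.2
      ((forces_mem_finName.1 hz).imp fun _ _ ⟨n, hn, he⟩ => ⟨n, ht hn, he⟩)
  refine ⟨forces_isFIN_finName _ p, forces_allIn.2 fun z q hq hz => ?_⟩
  refine (forces_mem_finName.1 hz).forces fun r hr ⟨n, hn, he⟩ => ?_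
  rcases FIN.mem_union.1 hn with hn | hn
  · refine (forces_exIn.1 (forces_allIn.1 hs.2 z r (hr.trans hq)
      (forces_mem_finName.2 (densely_of_forall fun _ h => ⟨n, hn, he.mono h⟩)))).forces
        fun r' hr' ⟨t, htY, hzt, hts⟩ => forces_exIn_of t htY ⟨hzt, ?_⟩
    exact forces_subset.2 fun v r'' hr'' hv =>
      forces_subset.1 (hmem Finset.subset_union_left r'') v r'' le_rfl
        (forces_subset.1 hts v r'' hr'' hv)
  · exact forces_exIn_of (finName Q y) (hy.mono (hr.trans hq))
      ⟨forces_mem_finName.2 (densely_of_forall fun _ h => ⟨n, hn, he.mono h⟩),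
        hmem Finset.subset_union_right r⟩

/-! ### The generic colouring -/

variable {H : Ultrafilter FIN} {π : Cond H → Q}

/-- `p` is a reduction of `q`. -/
def IsReduction (π : Cond H → Q) (p : Cond H) (q : Q) : Prop := ∀ p' ≤ p, Compat (π p') q

theorem IsReduction.mono {p p' : Cond H} (h : IsReduction π p q) (hp : p' ≤ p) :
    IsReduction π p' q := fun p'' hp'' => h p'' (hp''.trans hp)

/-- A reduction of `q` has an image compatible with `q`, hence with `π p₁`, and complete embeddings
reflect compatibility. -/
theorem IsReduction.exists_le (hπ : IsCompleteEmbedding π) {p p₁ : Cond H}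
    (h : IsReduction π p q) (hq : q ≤ π p₁) : ∃ p' ≤ p, p' ≤ p₁ := by
  obtain ⟨r, hr, hrq⟩ := h p le_rfl
  exact (hπ.compat_iff p p₁).2 ⟨r, hr, hrq.trans hq⟩

/-- Extensions of a reduction are again reductions, so the three conditions can be met one after
another. This replaces the fact that the preimage of a generic filter is a filter. -/
theorem IsCompleteEmbedding.exists_le_three (hπ : IsCompleteEmbedding π) {p₁ p₂ p₃ : Cond H}
    (h₁ : q ≤ π p₁) (h₂ : q ≤ π p₂) (h₃ : q ≤ π p₃) : ∃ p, p ≤ p₁ ∧ p ≤ p₂ ∧ p ≤ p₃ := by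
  obtain ⟨p, hp : IsReduction π p q⟩ := hπ.reduction q
  obtain ⟨p', hp', hp₁⟩ := hp.exists_le hπ h₁
  obtain ⟨p'', hp'', hp₂⟩ := (hp.mono hp').exists_le hπ h₂
  obtain ⟨p''', hp''', hp₃⟩ := ((hp.mono hp').mono hp'').exists_le hπ h₃
  exact ⟨p''', hp'''.trans (hp''.trans hp₁), hp'''.trans hp₂, hp₃⟩

/-- The conditions that put the pair `(s, t)` into the generic colouring. -/
def colouringCond (π : Cond H → Q) (s : FIN) (t : Bool) : Set Q :=
  {q | ∃ p, Decides p s t ∧ q = π p}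

theorem densely_colouringCond (hH : IsOrderedUnion H) (hπ : IsCompleteEmbedding π) (s : FIN)
    (q : Q) : Densely q fun r => ∃ t, ∃ q' ∈ colouringCond π s t, r ≤ q' := by
  intro q' _
  obtain ⟨p, hp⟩ := hπ.reduction q'
  obtain ⟨p', hp', t, ht⟩ := exists_decides hH p s
  obtain ⟨r, hr, hrq⟩ := hp p' hp'
  exact ⟨r, hrq, t, π p', ⟨p', ht, rfl⟩, hr⟩

/-- Two deciding conditions whose images lie above `r` have a common extension, and any branch of it
carries both colours. -/
theorem colouringCond_unique (hπ : IsCompleteEmbedding π) {s : FIN} {t t' : Bool} {r : Q}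
    (h : ∃ q ∈ colouringCond π s t, r ≤ q) (h' : ∃ q ∈ colouringCond π s t', r ≤ q) : t = t' := by
  obtain ⟨_, ⟨p₁, h₁, rfl⟩, hr₁⟩ := h
  obtain ⟨_, ⟨p₂, h₂, rfl⟩, hr₂⟩ := h'
  obtain ⟨p, hp₁, hp₂, -⟩ := hπ.exists_le_three hr₁ hr₂ hr₂
  obtain ⟨F, hF⟩ := p.2.branches_nonempty
  exact (h₁ F fun l => hp₁ (hF l)).symm.trans (h₂ F fun l => hp₂ (hF l))

theorem forces_isFun_genericColouring (hH : IsOrderedUnion H) (hπ : IsCompleteEmbedding π)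
    (q : Q) : q ⊩ .isFun .isFIN .isTwo (genericColouring π) :=
  forces_isFun_relName (fun _ _ => codeFIN_injective) (fun _ _ _ hx => forces_isFIN.1 hx)
    (fun s => forces_isFIN_finName s q) (fun t => forces_isTwo_codeBool t q)
    (fun s => densely_colouringCond hH hπ s q)
    (fun _ _ _ _ _ h h' => colouringCond_unique hπ h h')

theorem densely_of_forces_pairIn_genericColouring {s : FIN} {y : Name Q}
    (h : p ⊩ .pairIn (genericColouring π) (finName Q s) y) :
    Densely p fun r => ∃ t, (∃ p' : Cond H, Decides p' s t ∧ r ≤ π p') ∧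
      (r ⊩ .eq y (check Q (codeBool t))) :=
  (densely_of_forces_pairIn_relName (cond := colouringCond π)
    (fun _ _ => codeFIN_injective) h).imp fun _ _ ⟨t, ⟨_, ⟨p', hp', hq⟩, hr⟩, he⟩ =>
      ⟨t, ⟨p', hp', hq ▸ hr⟩, he⟩

/-- The generic colouring is not constant on `[Y]` if `[Y]` meets every member of `H`. -/
theorem not_forces_constant (hH : IsStableOrderedUnion H) (hQ : IsBounding Q)
    (hπ : IsCompleteEmbedding π) {Y t : Name Q} (hY : p ⊩ .isInfBlockSeq Y)
    (hYH : p ⊩ .allIn (check Q (codeUltrafilter H)) fun B => .exIn B fun s => .inUnions s Y) :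
    ¬ (p ⊩ .all fun s => .imp (.inUnions s Y) (.pairIn (genericColouring π) s t)) := by
  intro hc
  obtain ⟨q, hqp, ψ, hψ⟩ := hQ.exists_bound hY
  -- The function `ψ` must be known before the condition is thinned. Working below a reduction of
  -- `q` keeps the thinned condition `p₁` compatible with `q`.
  obtain ⟨p₀, hp₀⟩ := hπ.reduction q
  obtain ⟨p₁, hp₁, A, hA, hflip⟩ := exists_flipping hH p₀ ψ
  obtain ⟨r₀, hr₀, hr₀q⟩ := hp₀ p₁ hp₁
  have hmeet := forces_allIn.1 hYH (check Q (codeSet A)) r₀ (hr₀q.trans hqp)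
    (forces_check_mem (mem_codeUltrafilter.2 ⟨A, hA, .refl _⟩) r₀)
  obtain ⟨r₁, hr₁, z, hzA, hzY⟩ := (forces_exIn.1 hmeet).exists
  obtain ⟨r₂, hr₂, s, hs, he⟩ := (forces_mem_codeSet.1 hzA).exists
  obtain ⟨n, hn⟩ := hflip s hs
  obtain ⟨r₃, hr₃, y, hny, hyψ, hy⟩ := hψ n r₂ (hr₂.trans (hr₁.trans hr₀q))
  have hsY : r₃ ⊩ .inUnions (finName Q s) Y :=
    respects_inUnions Y _ _ _ (he.mono hr₃) (hzY.mono (hr₃.trans hr₂))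
  have hr₃p : r₃ ≤ p := hr₃.trans (hr₂.trans (hr₁.trans (hr₀q.trans hqp)))
  have hc₁ := forces_imp.1 (hc (finName Q s)) r₃ hr₃p hsY
  have hc₂ := forces_imp.1 (hc (finName Q (s.union y))) r₃ hr₃p
    (forces_inUnions_finName_union hsY hy)
  obtain ⟨r₄, hr₄, b, ⟨p₂, hp₂, hrp₂⟩, hb⟩ :=
    (densely_of_forces_pairIn_genericColouring hc₁).exists
  obtain ⟨r₅, hr₅, b', ⟨p₃, hp₃, hrp₃⟩, hb'⟩ :=
    (densely_of_forces_pairIn_genericColouring (hc₂.mono hr₄)).exists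
  obtain rfl := codeBool_injective (equiv_of_forces_check_eq ((hb.mono hr₅).symm.trans hb'))
  -- A branch through all three conditions gives `s` and `s ∪ y` the same colour by `p₂` and `p₃`,
  -- but different colours by `p₁`.
  obtain ⟨p', h₁, h₂, h₃⟩ := hπ.exists_le_three
    (hr₅.trans (hr₄.trans (hr₃.trans (hr₂.trans (hr₁.trans hr₀))))) (hr₅.trans hrp₂) hrp₃
  obtain ⟨F, hF⟩ := p'.2.branches_nonempty
  exact hn y hny hyψ F (fun l => h₁ (hF l))
    ((hp₃ F fun l => h₃ (hF l)).trans (hp₂ F fun l => h₂ (hF l)).symm)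

theorem forces_isWitness_genericColouring (hH : IsStableOrderedUnion H) (hQ : IsBounding Q)
    (hπ : IsCompleteEmbedding π) (q : Q) :
    q ⊩ .isWitness (genericColouring π) (check Q (codeUltrafilter H)) := by
  refine ⟨forces_isFun_genericColouring hH.1 hπ q, fun Y => forces_imp.2 fun q₁ _ hY =>
    forces_imp.2 fun q₂ hq₂ hYH q₃ hq₃ hc => ?_⟩
  obtain ⟨r, hr, t, ht⟩ := (forces_ex.1 hc).exists
  exact not_forces_constant hH hQ hπ (hY.mono (hr.trans (hq₃.trans hq₂)))
    (hYH.mono (hr.trans hq₃)) ht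

/-! ### Ultrafilters in the extension -/

variable (π) in
/-- The name of the set of all `s` to which the generic colouring gives the colour `1`. -/
def colourClass : Name Q :=
  .mk (ULift.{u} FIN) (fun s => finName Q s.down) (fun s => colouringCond π s.down true)

theorem forces_mem_colourClass {z : Name Q} : (p ⊩ .mem z (colourClass π)) ↔
    Densely p fun r => ∃ s, (∃ q ∈ colouringCond π s true, r ≤ q) ∧ (r ⊩ .eq z (finName Q s)) := by
  rw [colourClass, forces_mem_mk]
  exact ⟨fun h => h.imp fun r _ ⟨s, hs, he⟩ => ⟨s.down, hs, he⟩,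
    fun h => h.imp fun r _ ⟨s, hs, he⟩ => ⟨⟨s⟩, hs, he⟩⟩

theorem forces_subFIN_colourClass (p : Q) : p ⊩ .subFIN (colourClass π) :=
  forces_allIn.2 fun _ _ _ hz => forces_isFIN.2
    ((forces_mem_colourClass.1 hz).imp fun _ _ ⟨s, _, he⟩ => ⟨s, he⟩)

theorem forces_pairIn_of_mem_colourClass {z : Name Q} (h : p ⊩ .mem z (colourClass π)) :
    p ⊩ .pairIn (genericColouring π) z (check Q (codeBool true)) :=
  (forces_mem_colourClass.1 h).forces fun _ _ ⟨_, ⟨_, hq, hr⟩, he⟩ =>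
    respects_pairIn_mid _ _ _ _ _ he.symm
      (forces_pairIn_relName_of (cond := colouringCond π) hq hr)

theorem forces_pairIn_of_not_mem_colourClass (hH : IsOrderedUnion H)
    (hπ : IsCompleteEmbedding π) {z : Name Q} (hz : p ⊩ .isFIN z)
    (h : p ⊩ .neg (.mem z (colourClass π))) :
    p ⊩ .pairIn (genericColouring π) z (check Q (codeBool false)) := by
  refine (forces_isFIN.1 hz).forces fun r₁ hr₁ ⟨s, he⟩ => ?_
  refine (densely_colouringCond hH hπ s r₁).forces fun r hr ⟨t, q, hq, hrq⟩ => ?_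
  cases t with
  | false =>
    exact respects_pairIn_mid _ _ _ _ _ (he.mono hr).symm
      (forces_pairIn_relName_of (cond := colouringCond π) hq hrq)
  | true =>
    exact absurd (forces_mem_colourClass.2 (densely_of_forall fun r' hr' =>
      ⟨s, ⟨q, hq, hr'.trans hrq⟩, he.mono (hr'.trans hr)⟩)) (h r (hr.trans hr₁))

/-- If every member of `A ∈ U` gets the same colour, then `U` is not an ordered-union ultrafilter
that extends `H`. -/
theorem not_forces_constant_on_mem (hH : IsStableOrderedUnion H) (hQ : IsBounding Q)
    (hπ : IsCompleteEmbedding π) {U A t : Name Q} (hU : p ⊩ .isOrderedUnion U)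
    (hHU : p ⊩ .subset (check Q (codeUltrafilter H)) U) (hA : p ⊩ .mem A U)
    (hc : ∀ z, ∀ q ≤ p, (q ⊩ .mem z A) → (q ⊩ .pairIn (genericColouring π) z t)) : False := by
  obtain ⟨r, hr, Y, hY, hYU⟩ := (forces_ex.1 (forces_allIn.1 hU.2 A p le_rfl hA)).exists
  obtain ⟨r', hr', C, hCU, hCY, hCA⟩ := (forces_exIn.1 hYU).exists
  have hCY' : ∀ z, ∀ q ≤ r', (q ⊩ .mem z C) ↔ (q ⊩ .inUnions z Y) :=
    fun z => forces_iff.1 (hCY z)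
  refine not_forces_constant hH hQ hπ (t := t) (hY.mono hr') (forces_allIn.2 fun B q hq hB => ?_)
    fun z => forces_imp.2 fun q hq hz => hc z q (hq.trans (hr'.trans hr))
      (forces_subset.1 hCA z q hq ((hCY' z q hq).2 hz))
  have hqp : q ≤ p := hq.trans (hr'.trans hr)
  have hBU := forces_subset.1 hHU B q hqp hB
  -- For `B ∈ H` the intersection `B ∩ [Y]` belongs to `U`, so it is nonempty and `[Y]` meets `B`.
  refine (forces_exIn.1 (forces_allIn.1 (forces_allIn.1 hU.1.2.2.1 B q hqp hBU) C q le_rfl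
    (hCU.mono hq))).forces fun q₁ hq₁ ⟨E, hEU, hE⟩ => ?_
  refine (forces_ex.1 (forces_allIn.1 hU.1.1 E q₁ (hq₁.trans hqp) hEU).2).forces
    fun q₂ hq₂ ⟨z, hz⟩ => ?_
  have hz' := (forces_iff.1 (hE z) q₂ hq₂).1 hz
  exact forces_exIn_of z hz'.1 ((hCY' z q₂ (hq₂.trans (hq₁.trans hq))).1 hz'.2)

theorem forces_not_exists_isStableOrderedUnion (hH : IsStableOrderedUnion H) (hQ : IsBounding Q)
    (hπ : IsCompleteEmbedding π) (q : Q) : q ⊩ .neg (.ex fun U =>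
      .and (.isStableOrderedUnion U) (.subset (check Q (codeUltrafilter H)) U)) := by
  intro q₁ _ h
  obtain ⟨r, _, U, ⟨hU, -⟩, hHU⟩ := (forces_ex.1 h).exists
  obtain ⟨r', hr', h⟩ := (forces_or.1 (forces_imp.1 (hU.1.2.2.2 (colourClass π)) r le_rfl
    (forces_subFIN_colourClass r))).exists
  rcases h with h | h
  · exact not_forces_constant_on_mem hH hQ hπ (hU.mono hr') (hHU.mono hr') h
      fun z q _ hz => forces_pairIn_of_mem_colourClass hz
  · obtain ⟨s, hs, C, hCU, hC⟩ := (forces_exIn.1 h).exists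
    refine not_forces_constant_on_mem hH hQ hπ (hU.mono (hs.trans hr')) (hHU.mono (hs.trans hr'))
      (t := check Q (codeBool false)) hCU fun z q hq hz => ?_
    have hz' := (forces_iff.1 (hC z) q hq).1 hz
    exact forces_pairIn_of_not_mem_colourClass hH.1 hπ hz'.1 hz'.2

end Witness

end StableForcing

theorem mainTheorem4 (H : Ultrafilter FIN) (hH : IsStableOrderedUnion H)
    (Q : Type u) [Preorder Q] (hQ : IsBounding Q)
    (π : Cond H → Q) (hπ : IsCompleteEmbedding π) :
    (∀ q : Q, q ⊩ .neg (.ex fun U =>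
      .and (.isStableOrderedUnion U) (.subset (check Q (codeUltrafilter H)) U))) ∧
    (∀ q : Q, q ⊩ .isWitness (genericColouring π) (check Q (codeUltrafilter H))) := by
  exact ⟨forces_not_exists_isStableOrderedUnion hH hQ hπ,
    forces_isWitness_genericColouring hH hQ hπ⟩
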